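/- Let $B$ be a topological space and $R$ a commutative ring with unity. A fibrewise pointed space over $B$ is a topological space $X$ with continuous maps $p_X:X\to B$ and $s_X:B\to X$ such that $p_X\circ s_X=\mathrm{id}_B$. A fibrewise pointed map $f:X\to Y$ is a continuous map with $p_Y\circ f=p_X$ and $f\circ s_X=s_Y$. Two fibrewise pointed maps are fibrewise pointed homotopic, written $\simeq_B^B$, if they are homotopic through fibrewise pointed maps. The fibrewise pointed cohomology of $X$ is the relative singular cohomology $H_B^*(X)=H^*(X,s_X(B);R)$, a (non-unital) ring under the cup product; a fibrewise pointed map $\pi:E\to X$ induces a ring homomorphism $\pi^*:H_B^*(X)\to H_B^*(E)$. For a two-sided ideal $I$ of a ring, $\mathrm{nil}(I)$ is the least integer $k\ge 0$ such that $I^{k+1}=0$, i.e. such that every product of $k+1$ elements of $I$ vanishes ($\infty$ if there is none). For a fibrewise pointed map $\pi:E\to X$, $\mathrm{secat}_B^B(\pi)$ is the least integer $n\ge 0$ such that $X$ has an open cover $\{U_i\}_{i=0}^n$ with $s_X(B)\subseteq U_i$ for each $i$ and fibrewise pointed maps $\sigma_i:U_i\to E$ with $\pi\circ\sigma_i\simeq_B^B\mathrm{inc}_{U_i}$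 ($\infty$ if there is none). For fibrewise pointed maps $f,g:X\to Y$, $D_B^B(f,g)$ is the least integer $n\ge 0$ such that $X$ has an open cover $\{U_i\}_{i=0}^n$ with $s_X(B)\subseteq U_i$ and $f|_{U_i}\simeq_B^B g|_{U_i}$ for each $i$ ($\infty$ if there is none). Let $P_B(Y)=\{(b,\alpha)\in B\times Y^{[0,1]} : p_Y\circ\alpha \text{ is constant at } b\}$, where $Y^{[0,1]}$ is the space of paths with the compact-open topology; it is a fibrewise pointed space over $B$ with projection $(b,\alpha)\mapsto b$ and section $b\mapsto (b,\text{the constant path at } s_Y(b))$. Let $\Pi_Y:P_B(Y)\to Y\times_B Y$ be the map $(b,\alpha)\mapsto(\alpha(0),\alpha(1))$, and let $\widetilde\Pi_Y:\mathcal P_B(f,g)\to X$ be the pullback of $\Pi_Y$ along $(f,g):X\to Y\times_B Y$; it is a fibrewise pointed map, where $\mathcal P_B(f,g)$ has the section induced by those of $X$ and $P_B(Y)$. **Theorem.** (1) For every fibrewise pointed map $\pi:E\to X$ over $B$, $$\mathrm{nil}(\ker \pi^*)\le \mathrm{secat}_B^B(\pi).$$ (2) For all fibrewise pointed maps $f,g:X\to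 Y$ over $B$, $$\mathrm{nil}\bigl(\ker(\widetilde\Pi_Y^*:H_B^*(X)\to H_B^*(\mathcal P_B(f,g)))\bigr)\le D_B^B(f,g).$$ -/

import Mathlib

open scoped DirectSum

noncomputable section

namespace FibrewisePointed

/-! ### Singular cohomology of pairs, with cup products -/

section Cochains

variable {X Y : Type*} [TopologicalSpace X] [TopologicalSpace Y]

/-- Singular `n`-simplices of `X`. -/
abbrev Simplex (X : Type*) [TopologicalSpace X] (n : ℕ) : Type _ :=
  C(stdSimplex ℝ (Fin (n + 1)), X)

/-- The affine map of standard simplices induced by a map of vertices. -/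
def vertexMap {m n : ℕ} (a : Fin (m + 1) → Fin (n + 1)) :
    C(stdSimplex ℝ (Fin (m + 1)), stdSimplex ℝ (Fin (n + 1))) :=
  ⟨stdSimplex.map a, stdSimplex.continuous_map a⟩

/-- Precomposition of a singular simplex with the affine map induced by a map of vertices. -/
def Simplex.pull {m n : ℕ} (a : Fin (m + 1) → Fin (n + 1)) (σ : Simplex X n) : Simplex X m :=
  σ.comp (vertexMap a)

theorem Simplex.pull_pull {l m n : ℕ} (a : Fin (l + 1) → Fin (m + 1))
    (b : Fin (m + 1) → Fin (n + 1)) (σ : Simplex X n) :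
    (σ.pull b).pull a = σ.pull (b ∘ a) := by
  ext x
  simp only [Simplex.pull, vertexMap, ContinuousMap.comp_apply, ContinuousMap.coe_mk]
  rw [stdSimplex.map_comp_apply]

theorem Simplex.range_pull {m n : ℕ} (a : Fin (m + 1) → Fin (n + 1)) (σ : Simplex X n) :
    Set.range (σ.pull a) ⊆ Set.range σ := by
  rintro _ ⟨x, rfl⟩
  exact ⟨vertexMap a x, rfl⟩

/-- The inclusion of the first `p + 1` vertices. -/
def front {p n : ℕ} (h : p ≤ n) (i : Fin (p + 1)) : Fin (n + 1) := ⟨i, by omega⟩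

/-- The inclusion of the last `q + 1` vertices, starting at vertex `p`. -/
def back {p q n : ℕ} (h : p + q = n) (i : Fin (q + 1)) : Fin (n + 1) := ⟨p + i, by omega⟩

variable (R : Type*) [CommRing R]

/-- Singular `n`-cochains of `X` with coefficients in `R`. -/
abbrev Cochain (X : Type*) [TopologicalSpace X] (n : ℕ) : Type _ := Simplex X n → R

variable {R}

/-- The coboundary `(δ φ) σ = ∑ i, (-1) ^ i φ (σ ∘ dᵢ)`. -/
def coboundary (X : Type*) [TopologicalSpace X] (n : ℕ) :
    Cochain R X n →ₗ[R] Cochain R X (n + 1) where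
  toFun φ σ := ∑ i : Fin (n + 2), (-1) ^ (i : ℕ) * φ (σ.pull i.succAbove)
  map_add' φ ψ := by
    ext σ
    simp [mul_add, Finset.sum_add_distrib]
  map_smul' c φ := by
    ext σ
    simp [Finset.mul_sum, mul_left_comm]

/-- The cup product of cochains: front face times back face. -/
def cup {p q n : ℕ} (h : p + q = n) (φ : Cochain R X p) (ψ : Cochain R X q) : Cochain R X n :=
  fun σ => φ (σ.pull (front (by omega))) * ψ (σ.pull (back h))

/-- Pullback of cochains along a continuous map. -/
def pullCochain (f : C(X, Y)) (n : ℕ) : Cochain R Y n →ₗ[R] Cochain R X n where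
  toFun φ σ := φ (f.comp σ)
  map_add' _ _ := rfl
  map_smul' _ _ := rfl

theorem coboundary_pullCochain (f : C(X, Y)) (n : ℕ) (φ : Cochain R Y n) :
    coboundary X n (pullCochain f n φ) = pullCochain f (n + 1) (coboundary Y n φ) := rfl

theorem cup_pullCochain (f : C(X, Y)) {p q n : ℕ} (h : p + q = n) (φ : Cochain R Y p)
    (ψ : Cochain R Y q) :
    cup h (pullCochain f p φ) (pullCochain f q ψ) = pullCochain f n (cup h φ ψ) := rfl

/-- The Leibniz rule. -/
theorem coboundary_cup {p q n : ℕ} (h : p + q = n) (φ : Cochain R X p) (ψ : Cochain R X q) :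
    coboundary X n (cup h φ ψ) =
      cup (show (p + 1) + q = n + 1 by omega) (coboundary X p φ) ψ +
        (-1 : R) ^ p • cup (show p + (q + 1) = n + 1 by omega) φ (coboundary X q ψ) := by
  subst h
  ext σ
  simp only [coboundary, cup, LinearMap.coe_mk, AddHom.coe_mk, Pi.add_apply, Pi.smul_apply,
    smul_eq_mul, Simplex.pull_pull]
  have e : p + q + 2 = (p + 1) + (q + 1) := by omega
  rw [← (finCongr e).symm.sum_comp, Fin.sum_univ_add]
  rw [Fin.sum_univ_castSucc (n := p + 1), Fin.sum_univ_succ (n := q + 1)]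
  have h1 : ∀ i : Fin (p + 1),
      (((finCongr e).symm (Fin.castAdd (q + 1) i)).succAbove ∘
        front (show p ≤ p + q by omega) : Fin (p + 1) → Fin (p + q + 2)) =
        front (show p + 1 ≤ p + q + 1 by omega) ∘ i.castSucc.succAbove := by
    intro i
    funext j
    ext
    simp only [Function.comp, front, Fin.succAbove, Fin.lt_def]
    simp
    split_ifs <;> simp
  have h2 : ∀ i : Fin (p + 1),
      (((finCongr e).symm (Fin.castAdd (q + 1) i)).succAbove ∘
        back (show p + q = p + q from rfl) : Fin (q + 1) → Fin (p + q + 2)) =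
        back (show (p + 1) + q = p + q + 1 by omega) := by
    intro i
    funext j
    ext
    simp only [Function.comp, back, Fin.succAbove, Fin.lt_def]
    simp
    split_ifs <;> simp <;> omega
  have h3 : ∀ i : Fin (q + 1),
      (((finCongr e).symm (Fin.natAdd (p + 1) i)).succAbove ∘
        front (show p ≤ p + q by omega) : Fin (p + 1) → Fin (p + q + 2)) =
        front (show p ≤ p + q + 1 by omega) := by
    intro i
    funext j
    ext
    simp only [Function.comp, front, Fin.succAbove, Fin.lt_def]
    simp
    split_ifs <;> simp <;> omega
  have h4 : ∀ i : Fin (q + 1),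
      (((finCongr e).symm (Fin.natAdd (p + 1) i)).succAbove ∘
        back (show p + q = p + q from rfl) : Fin (q + 1) → Fin (p + q + 2)) =
        back (show p + (q + 1) = p + q + 1 by omega) ∘ i.succ.succAbove := by
    intro i
    funext j
    ext
    simp only [Function.comp, back, Fin.succAbove, Fin.lt_def]
    simp
    split_ifs <;> simp <;> omega
  have h5 : (front (show p + 1 ≤ p + q + 1 by omega) ∘ (Fin.last (p + 1)).succAbove :
      Fin (p + 1) → Fin (p + q + 2)) = front (show p ≤ p + q + 1 by omega) := by
    funext j
    ext
    simp [front]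
  have h6 : (back (show p + (q + 1) = p + q + 1 by omega) ∘ (0 : Fin (q + 2)).succAbove :
      Fin (q + 1) → Fin (p + q + 2)) = back (show (p + 1) + q = p + q + 1 by omega) := by
    funext j
    ext
    simp [back]
    omega
  simp only [h1, h2, h3, h4, h5, h6]
  simp only [add_mul, mul_add, Finset.sum_mul, Finset.mul_sum]
  have v1 : ∀ i : Fin (p + 1), (((finCongr e).symm (Fin.castAdd (q + 1) i) : Fin _) : ℕ) = i :=
    fun i => by simp
  have v2 : ∀ i : Fin (q + 1),
      (((finCongr e).symm (Fin.natAdd (p + 1) i) : Fin _) : ℕ) = p + 1 + i := fun i => by simp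
  simp only [v1, v2, Fin.val_castSucc, Fin.val_last, Fin.val_succ, Fin.val_zero]
  have s1 : ∀ i : Fin (q + 1), ∀ a b : R,
      (-1) ^ (p + 1 + (i : ℕ)) * (a * b) = (-1) ^ p * (a * ((-1) ^ ((i : ℕ) + 1) * b)) := by
    intro i a b
    ring
  simp only [s1]
  have s2 : ∀ a b : R, (-1) ^ (p + 1) * a * b + (-1) ^ p * (a * ((-1) ^ 0 * b)) = 0 := by
    intro a b
    ring
  linear_combination (norm :=
      (ring_nf; exact sub_eq_zero.mpr (Finset.sum_congr rfl fun _ _ => by ring))) -s2 (φ (σ.pull (front (show p ≤ p + q + 1 by omega))))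
    (ψ (σ.pull (back (show (p + 1) + q = p + q + 1 by omega))))

end Cochains

section Cohomology

variable (R : Type*) [CommRing R]
variable (X : Type*) [TopologicalSpace X] (A : Set X)

/-- Relative cochains of `(X, A)`: cochains which vanish on the simplices of `A`. -/
def relCochains (n : ℕ) : Submodule R (Cochain R X n) where
  carrier := {φ | ∀ σ : Simplex X n, Set.range σ ⊆ A → φ σ = 0}
  add_mem' {φ ψ} hφ hψ σ hσ := by simp [hφ σ hσ, hψ σ hσ]
  zero_mem' _ _ := rfl
  smul_mem' c φ hφ σ hσ := by simp [hφ σ hσ]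

/-- Relative cocycles of `(X, A)`. -/
def cocycles (n : ℕ) : Submodule R (Cochain R X n) :=
  relCochains R X A n ⊓ LinearMap.ker (coboundary X n)

/-- Relative coboundaries of `(X, A)`. -/
def coboundaries : (n : ℕ) → Submodule R (Cochain R X n)
  | 0 => ⊥
  | n + 1 => (relCochains R X A n).map (coboundary X n)

/-- The relative singular cohomology module `Hⁿ(X, A; R)`. -/
def Cohomology (n : ℕ) : Type _ :=
  cocycles R X A n ⧸ (coboundaries R X A n).comap (cocycles R X A n).subtype

instance (n : ℕ) : AddCommGroup (Cohomology R X A n) :=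
  inferInstanceAs
    (AddCommGroup (cocycles R X A n ⧸ (coboundaries R X A n).comap (cocycles R X A n).subtype))

instance (n : ℕ) : Module R (Cohomology R X A n) :=
  inferInstanceAs
    (Module R (cocycles R X A n ⧸ (coboundaries R X A n).comap (cocycles R X A n).subtype))

/-- The total relative singular cohomology `H^*(X, A; R)`. -/
abbrev TotalCohomology : Type _ := ⨁ n, Cohomology R X A n

variable {R X A}

theorem coboundary_mem_relCochains {n : ℕ} {φ : Cochain R X n} (hφ : φ ∈ relCochains R X A n) :
    coboundary X n φ ∈ relCochains R X A (n + 1) := by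
  intro σ hσ
  change ∑ i : Fin (n + 2), (-1) ^ (i : ℕ) * φ (σ.pull i.succAbove) = 0
  refine Finset.sum_eq_zero fun i _ => ?_
  rw [hφ _ ((σ.range_pull _).trans hσ), mul_zero]

theorem cup_mem_relCochains {p q n : ℕ} (h : p + q = n) {φ : Cochain R X p}
    (hφ : φ ∈ relCochains R X A p) (ψ : Cochain R X q) : cup h φ ψ ∈ relCochains R X A n := by
  intro σ hσ
  simp only [cup]
  rw [hφ _ ((σ.range_pull _).trans hσ), zero_mul]

theorem cup_mem_cocycles {p q n : ℕ} (h : p + q = n) {φ : Cochain R X p} {ψ : Cochain R X q}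
    (hφ : φ ∈ cocycles R X A p) (hψ : ψ ∈ cocycles R X A q) : cup h φ ψ ∈ cocycles R X A n := by
  refine ⟨cup_mem_relCochains h hφ.1 ψ, ?_⟩
  have h1 : coboundary X p φ = 0 := hφ.2
  have h2 : coboundary X q ψ = 0 := hψ.2
  change coboundary X n (cup h φ ψ) = 0
  rw [coboundary_cup, h1, h2]
  ext σ
  simp [cup]

theorem cup_mem_coboundaries_left {p q n : ℕ} (h : p + q = n) {φ : Cochain R X p}
    {ψ : Cochain R X q} (hφ : φ ∈ coboundaries R X A p) (hψ : ψ ∈ cocycles R X A q) :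
    cup h φ ψ ∈ coboundaries R X A n := by
  cases p with
  | zero =>
    have h0 : φ = 0 := hφ
    have h1 : cup h φ ψ = 0 := by
      ext σ
      simp [cup, h0]
    rw [h1]
    exact zero_mem _
  | succ p =>
    obtain ⟨χ, hχ, rfl⟩ := hφ
    obtain ⟨m, rfl⟩ : ∃ m, n = m + 1 := ⟨p + q, by omega⟩
    refine ⟨cup (show p + q = m by omega) χ ψ, cup_mem_relCochains _ hχ ψ, ?_⟩
    have h2 : coboundary X q ψ = 0 := hψ.2
    rw [coboundary_cup, h2]
    ext σ
    simp [cup]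

theorem cup_mem_coboundaries_right {p q n : ℕ} (h : p + q = n) {φ : Cochain R X p}
    {ψ : Cochain R X q} (hφ : φ ∈ cocycles R X A p) (hψ : ψ ∈ coboundaries R X A q) :
    cup h φ ψ ∈ coboundaries R X A n := by
  cases q with
  | zero =>
    have h0 : ψ = 0 := hψ
    have h1 : cup h φ ψ = 0 := by
      ext σ
      simp [cup, h0]
    rw [h1]
    exact zero_mem _
  | succ q =>
    obtain ⟨χ, hχ, rfl⟩ := hψ
    obtain ⟨m, rfl⟩ : ∃ m, n = m + 1 := ⟨p + q, by omega⟩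
    refine ⟨(-1 : R) ^ p • cup (show p + q = m by omega) φ χ,
      Submodule.smul_mem _ _ (cup_mem_relCochains _ hφ.1 χ), ?_⟩
    have h2 : coboundary X p φ = 0 := hφ.2
    rw [map_smul, coboundary_cup, h2, smul_add, smul_smul, ← mul_pow]
    ext σ
    simp [cup]

/-- The cohomology class of a relative cocycle. -/
def cls (n : ℕ) : cocycles R X A n →ₗ[R] Cohomology R X A n := Submodule.mkQ _

theorem cls_surjective (n : ℕ) : Function.Surjective (cls (R := R) (X := X) (A := A) n) :=
  Submodule.mkQ_surjective _

theorem cls_eq_zero {n : ℕ} {φ : cocycles R X A n}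
    (h : (φ : Cochain R X n) ∈ coboundaries R X A n) : cls n φ = 0 :=
  (Submodule.Quotient.mk_eq_zero _).2 h

/-- Linear maps out of cohomology, defined on cocycles. -/
def Cohomology.lift {n : ℕ} {M : Type*} [AddCommGroup M] [Module R M]
    (l : cocycles R X A n →ₗ[R] M)
    (hl : ∀ φ : cocycles R X A n, (φ : Cochain R X n) ∈ coboundaries R X A n → l φ = 0) :
    Cohomology R X A n →ₗ[R] M :=
  Submodule.liftQ _ l (fun φ hφ => hl φ hφ)

theorem Cohomology.lift_cls {n : ℕ} {M : Type*} [AddCommGroup M] [Module R M]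
    (l : cocycles R X A n →ₗ[R] M)
    (hl : ∀ φ : cocycles R X A n, (φ : Cochain R X n) ∈ coboundaries R X A n → l φ = 0)
    (φ : cocycles R X A n) : Cohomology.lift l hl (cls n φ) = l φ := rfl

/-- The cup product of cocycles. -/
def cupCocycle (p q : ℕ) :
    cocycles R X A p →ₗ[R] cocycles R X A q →ₗ[R] cocycles R X A (p + q) :=
  LinearMap.mk₂ R
    (fun φ ψ => ⟨cup rfl (φ : Cochain R X p) (ψ : Cochain R X q), cup_mem_cocycles rfl φ.2 ψ.2⟩)
    (fun _ _ _ => by ext σ; simp [cup, add_mul])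
    (fun _ _ _ => by ext σ; simp [cup, mul_assoc])
    (fun _ _ _ => by ext σ; simp [cup, mul_add])
    (fun _ _ _ => by ext σ; simp [cup, mul_left_comm])

/-- The cup product `Hᵖ(X, A) × H^q(X, A) → H^(p+q)(X, A)`. -/
def cupCohomology (p q : ℕ) :
    Cohomology R X A p →ₗ[R] Cohomology R X A q →ₗ[R] Cohomology R X A (p + q) :=
  Cohomology.lift
    (LinearMap.flip (Cohomology.lift
      (LinearMap.flip ((cupCocycle p q).compr₂ (cls (p + q))))
      (fun ψ hψ => by
        ext φ
        exact cls_eq_zero (cup_mem_coboundaries_right rfl φ.2 hψ))))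
    (fun φ hφ => by
      ext b
      obtain ⟨ψ, rfl⟩ := cls_surjective q b
      exact cls_eq_zero (cup_mem_coboundaries_left rfl hφ ψ.2))

theorem cupCohomology_cls {p q : ℕ} (φ : cocycles R X A p) (ψ : cocycles R X A q) :
    cupCohomology p q (cls p φ) (cls q ψ) = cls (p + q) (cupCocycle p q φ ψ) := rfl

instance : DirectSum.GNonUnitalNonAssocSemiring (Cohomology R X A) where
  mul a b := cupCohomology _ _ a b
  mul_zero a := map_zero _
  zero_mul b := by simp
  mul_add a b c := map_add _ b c
  add_mul a b c := by simp

theorem of_mul_of_cls {p q : ℕ} (φ : cocycles R X A p) (ψ : cocycles R X A q) :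
    (DirectSum.of (Cohomology R X A) p (cls p φ) * DirectSum.of (Cohomology R X A) q (cls q ψ) :
      TotalCohomology R X A) =
      DirectSum.of (Cohomology R X A) (p + q) (cls (p + q) (cupCocycle p q φ ψ)) :=
  DirectSum.of_mul_of _ _

theorem of_cls_cup_eq {p q n m : ℕ} (hm : p + q = m) (hn : p + q = n) {φ : Cochain R X p}
    {ψ : Cochain R X q} (hφ : cup hm φ ψ ∈ cocycles R X A m)
    (hψ : cup hn φ ψ ∈ cocycles R X A n) :
    DirectSum.of (Cohomology R X A) m (cls m ⟨_, hφ⟩) =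
      DirectSum.of (Cohomology R X A) n (cls n ⟨_, hψ⟩) := by
  subst hm
  subst hn
  rfl

theorem cup_assoc {p q r m l n : ℕ} (hm : p + q = m) (hl : q + r = l) (h1 : m + r = n)
    (h2 : p + l = n) (φ : Cochain R X p) (ψ : Cochain R X q) (χ : Cochain R X r) :
    cup h1 (cup hm φ ψ) χ = cup h2 φ (cup hl ψ χ) := by
  subst hm hl h2
  ext σ
  simp only [cup, Simplex.pull_pull, mul_assoc]
  congr 4
  funext i
  ext
  simp [back, Nat.add_assoc]

theorem totalCohomology_mul_assoc (a b c : TotalCohomology R X A) :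
    a * b * c = a * (b * c) := by
  induction a using DirectSum.induction_on with
  | zero => simp
  | add a a' h h' => rw [add_mul, add_mul, add_mul, h, h']
  | of p a =>
  induction b using DirectSum.induction_on with
  | zero => simp
  | add b b' h h' => rw [mul_add, add_mul, add_mul, mul_add, h, h']
  | of q b =>
  induction c using DirectSum.induction_on with
  | zero => simp
  | add c c' h h' => rw [mul_add, mul_add, mul_add, h, h']
  | of r c =>
  obtain ⟨a, rfl⟩ := cls_surjective p a
  obtain ⟨b, rfl⟩ := cls_surjective q b
  obtain ⟨c, rfl⟩ := cls_surjective r c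
  simp only [of_mul_of_cls]
  have hc := cup_mem_cocycles (n := p + q + r) (Nat.add_assoc p q r).symm a.2
    (cup_mem_cocycles rfl b.2 c.2)
  have h1 : cupCocycle (p + q) r (cupCocycle p q a b) c = ⟨_, hc⟩ :=
    Subtype.ext (cup_assoc rfl rfl rfl _ _ _ _)
  rw [h1]
  exact of_cls_cup_eq (Nat.add_assoc p q r).symm rfl hc _

/-- `H^*(X, A; R)` is an associative ring under the cup product, in general without unit. -/
instance : NonUnitalRing (TotalCohomology R X A) :=
  { (inferInstance : AddCommGroup (TotalCohomology R X A)),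
    (inferInstance : NonUnitalNonAssocSemiring (TotalCohomology R X A)) with
    mul_assoc := totalCohomology_mul_assoc }

section Induced

variable {Y : Type*} [TopologicalSpace Y] {A' : Set Y}

theorem pullCochain_mem_relCochains (f : C(X, Y)) (hf : Set.MapsTo f A A') {n : ℕ}
    {φ : Cochain R Y n} (hφ : φ ∈ relCochains R Y A' n) :
    pullCochain f n φ ∈ relCochains R X A n := by
  intro σ hσ
  refine hφ _ ?_
  rintro _ ⟨x, rfl⟩
  exact hf (hσ ⟨x, rfl⟩)

theorem pullCochain_mem_cocycles (f : C(X, Y)) (hf : Set.MapsTo f A A') {n : ℕ}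
    {φ : Cochain R Y n} (hφ : φ ∈ cocycles R Y A' n) :
    pullCochain f n φ ∈ cocycles R X A n := by
  refine ⟨pullCochain_mem_relCochains f hf hφ.1, ?_⟩
  have h1 : coboundary Y n φ = 0 := hφ.2
  change coboundary X n (pullCochain f n φ) = 0
  rw [coboundary_pullCochain, h1, map_zero]

theorem pullCochain_mem_coboundaries (f : C(X, Y)) (hf : Set.MapsTo f A A') {n : ℕ}
    {φ : Cochain R Y n} (hφ : φ ∈ coboundaries R Y A' n) :
    pullCochain f n φ ∈ coboundaries R X A n := by
  cases n with
  | zero =>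
    have h0 : φ = 0 := hφ
    rw [h0, map_zero]
    exact zero_mem _
  | succ n =>
    obtain ⟨χ, hχ, rfl⟩ := hφ
    exact ⟨pullCochain f n χ, pullCochain_mem_relCochains f hf hχ, rfl⟩

/-- The map induced in degree `n` cohomology by a map of pairs `(X, A) → (Y, A')`. -/
def cohomologyMap (f : C(X, Y)) (hf : Set.MapsTo f A A') (n : ℕ) :
    Cohomology R Y A' n →ₗ[R] Cohomology R X A n :=
  Cohomology.lift
    (cls n ∘ₗ (pullCochain f n).restrict (fun _ hφ => pullCochain_mem_cocycles f hf hφ))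
    (fun _ hφ => cls_eq_zero (pullCochain_mem_coboundaries f hf hφ))

theorem map_cohomologyMap_mul (f : C(X, Y)) (hf : Set.MapsTo f A A')
    (a b : TotalCohomology R Y A') :
    DirectSum.map (fun n => (cohomologyMap (R := R) f hf n).toAddMonoidHom) (a * b) =
      DirectSum.map (fun n => (cohomologyMap (R := R) f hf n).toAddMonoidHom) a *
        DirectSum.map (fun n => (cohomologyMap (R := R) f hf n).toAddMonoidHom) b := by
  induction a using DirectSum.induction_on with
  | zero => simp
  | add a a' h h' => rw [add_mul, map_add, map_add, add_mul, h, h']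
  | of p a =>
  induction b using DirectSum.induction_on with
  | zero => simp
  | add b b' h h' => rw [mul_add, map_add, map_add, mul_add, h, h']
  | of q b =>
  obtain ⟨a, rfl⟩ := cls_surjective p a
  obtain ⟨b, rfl⟩ := cls_surjective q b
  rw [DirectSum.of_mul_of, DirectSum.map_of, DirectSum.map_of, DirectSum.map_of,
    DirectSum.of_mul_of]
  rfl

/-- The ring homomorphism `H^*(Y, A'; R) → H^*(X, A; R)` induced by a map of pairs. -/
def totalCohomologyMap (R : Type*) [CommRing R] (f : C(X, Y)) (hf : Set.MapsTo f A A') :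
    TotalCohomology R Y A' →ₙ+* TotalCohomology R X A :=
  { DirectSum.map (fun n => (cohomologyMap (R := R) f hf n).toAddMonoidHom) with
    map_mul' := map_cohomologyMap_mul f hf }

end Induced

end Cohomology

/-! ### Nilpotency of an ideal -/

/-- The product `a₀ a₁ ⋯ aₖ` in a ring without unit. -/
def mulSeq {S : Type*} [NonUnitalRing S] : (k : ℕ) → (Fin (k + 1) → S) → S
  | 0, a => a 0
  | k + 1, a => mulSeq k (fun i => a i.castSucc) * a (Fin.last (k + 1))

/-- The nilpotency `nil I`: the least `k` with `I ^ (k + 1) = 0`, i.e. such that all products of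
`k + 1` elements of `I` vanish, and `⊤` if there is none. -/
def nilpotency {S : Type*} [NonUnitalRing S] (I : TwoSidedIdeal S) : ℕ∞ :=
  ⨅ (k : ℕ) (_ : ∀ a : Fin (k + 1) → S, (∀ i, a i ∈ I) → mulSeq k a = 0), (k : ℕ∞)

/-! ### Fibrewise pointed spaces -/

universe u v w

/-- A fibrewise pointed space over `B`. -/
structure Space (B : Type u) [TopologicalSpace B] where
  carrier : Type v
  [top : TopologicalSpace carrier]
  proj : C(carrier, B)
  sec : C(B, carrier)
  proj_sec : ∀ b, proj (sec b) = b

instance {B : Type u} [TopologicalSpace B] : CoeSort (Space.{u, v} B) (Type v) := ⟨Space.carrier⟩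

instance {B : Type u} [TopologicalSpace B] (X : Space.{u, v} B) : TopologicalSpace X := X.top

variable {B : Type u} [TopologicalSpace B]

/-- A continuous map is fibrewise pointed if it commutes with projections and sections. -/
def IsFibrewisePointed (X : Space.{u, v} B) (Y : Space.{u, w} B) (f : C(X, Y)) : Prop :=
  (∀ x, Y.proj (f x) = X.proj x) ∧ ∀ b, f (X.sec b) = Y.sec b

/-- Fibrewise pointed maps. -/
structure Map (X : Space.{u, v} B) (Y : Space.{u, w} B) where
  toMap : C(X, Y)
  isFibrewisePointed : IsFibrewisePointed X Y toMap

/-- Fibrewise pointed homotopy: a homotopy through fibrewise pointed maps. -/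
def Map.Homotopic {X : Space.{u, v} B} {Y : Space.{u, w} B} (f g : Map X Y) : Prop :=
  ContinuousMap.HomotopicWith f.toMap g.toMap (IsFibrewisePointed X Y)

/-- Composition of fibrewise pointed maps. -/
def Map.comp {X Y Z : Space B} (g : Map Y Z) (f : Map X Y) : Map X Z where
  toMap := g.toMap.comp f.toMap
  isFibrewisePointed :=
    ⟨fun x => by simp [g.isFibrewisePointed.1, f.isFibrewisePointed.1],
      fun b => by simp [g.isFibrewisePointed.2, f.isFibrewisePointed.2]⟩

/-- A subspace containing the section, as a fibrewise pointed space. -/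
def Space.subspace (X : Space.{u, v} B) (U : Set X) (hU : Set.range X.sec ⊆ U) :
    Space.{u, v} B where
  carrier := U
  proj := X.proj.comp ⟨Subtype.val, continuous_subtype_val⟩
  sec := ⟨fun b => ⟨X.sec b, hU ⟨b, rfl⟩⟩, by fun_prop⟩
  proj_sec b := X.proj_sec b

/-- The inclusion of a fibrewise pointed subset. -/
def Space.incl (X : Space.{u, v} B) (U : Set X) (hU : Set.range X.sec ⊆ U) :
    Map (X.subspace U hU) X where
  toMap := ⟨Subtype.val, continuous_subtype_val⟩
  isFibrewisePointed := ⟨fun _ => rfl, fun _ => rfl⟩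

/-- The fibrewise pointed sectional category of a fibrewise pointed map. -/
def secat {E : Space.{u, v} B} {X : Space.{u, w} B} (f : Map E X) : ℕ∞ :=
  ⨅ (n : ℕ) (_ : ∃ U : Fin (n + 1) → Set X, (∀ i, IsOpen (U i)) ∧ (⋃ i, U i) = Set.univ ∧
    ∀ i, ∃ hi : Set.range X.sec ⊆ U i, ∃ s : Map (X.subspace (U i) hi) E,
      (f.comp s).Homotopic (X.incl (U i) hi)), (n : ℕ∞)

/-- The parametrized pointed homotopic distance of two fibrewise pointed maps. -/
def distance {X : Space.{u, v} B} {Y : Space.{u, w} B} (f g : Map X Y) : ℕ∞ :=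
  ⨅ (n : ℕ) (_ : ∃ U : Fin (n + 1) → Set X, (∀ i, IsOpen (U i)) ∧ (⋃ i, U i) = Set.univ ∧
    ∀ i, ∃ hi : Set.range X.sec ⊆ U i,
      (f.comp (X.incl (U i) hi)).Homotopic (g.comp (X.incl (U i) hi))), (n : ℕ∞)

/-- The fibrewise product `Y ×_B Y`. -/
def Space.square (Y : Space.{u, v} B) : Space.{u, v} B where
  carrier := {y : Y × Y // Y.proj y.1 = Y.proj y.2}
  proj := ⟨fun y => Y.proj y.1.2, by fun_prop⟩
  sec := ⟨fun b => ⟨(Y.sec b, Y.sec b), rfl⟩, by fun_prop⟩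
  proj_sec b := Y.proj_sec b

/-- The fibrewise path space `P_B(Y)`, with section the constant paths at the section of `Y`. -/
def Space.paths (Y : Space.{u, v} B) : Space.{u, max u v} B where
  carrier := {z : B × C(unitInterval, Y) //
    ContinuousMap.const unitInterval z.1 = Y.proj.comp z.2}
  proj := ⟨fun z => z.1.1, by fun_prop⟩
  sec := ⟨fun b => ⟨(b, ContinuousMap.const unitInterval (Y.sec b)), by
    ext t
    simp [Y.proj_sec]⟩, by
    refine Continuous.subtype_mk ?_ _
    exact continuous_id.prodMk (ContinuousMap.continuous_const'.comp Y.sec.continuous)⟩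
  proj_sec _ := rfl

/-- The fibrewise pointed map `Π_Y : P_B(Y) → Y ×_B Y`, `(b, α) ↦ (α 0, α 1)`. -/
def Space.endpoints (Y : Space.{u, v} B) : Map Y.paths Y.square where
  toMap := ⟨fun z => ⟨(z.1.2 0, z.1.2 1),
    (DFunLike.congr_fun z.2 0).symm.trans (DFunLike.congr_fun z.2 1)⟩, by
    refine Continuous.subtype_mk ?_ _
    exact ((ContinuousEvalConst.continuous_eval_const 0).comp
      (continuous_snd.comp continuous_subtype_val)).prodMk
      ((ContinuousEvalConst.continuous_eval_const 1).comp
      (continuous_snd.comp continuous_subtype_val))⟩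
  isFibrewisePointed := ⟨fun z => (DFunLike.congr_fun z.2 1).symm, fun _ => rfl⟩

/-- The fibrewise pointed map `(f, g) : X → Y ×_B Y`. -/
def Map.pair {X : Space.{u, v} B} {Y : Space.{u, w} B} (f g : Map X Y) : Map X Y.square where
  toMap := ⟨fun x => ⟨(f.toMap x, g.toMap x),
    (f.isFibrewisePointed.1 x).trans (g.isFibrewisePointed.1 x).symm⟩, by fun_prop⟩
  isFibrewisePointed := ⟨fun x => g.isFibrewisePointed.1 x, fun b =>
    Subtype.ext (Prod.ext (f.isFibrewisePointed.2 b) (g.isFibrewisePointed.2 b))⟩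

/-- The space `𝒫_B(f, g)`: the pullback of `Π_Y` along `(f, g)`. -/
def pathPullback {X : Space.{u, v} B} {Y : Space.{u, w} B} (f g : Map X Y) :
    Space.{u, max u v w} B where
  carrier := {z : X × Y.paths // (f.pair g).toMap z.1 = Y.endpoints.toMap z.2}
  proj := ⟨fun z => X.proj z.1.1, by fun_prop⟩
  sec := ⟨fun b => ⟨(X.sec b, Y.paths.sec b),
    ((f.pair g).isFibrewisePointed.2 b).trans (Y.endpoints.isFibrewisePointed.2 b).symm⟩,
    by fun_prop⟩
  proj_sec b := X.proj_sec b

/-- The fibrewise pointed map `Π̃_Y : 𝒫_B(f, g) → X`. -/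
def pathPullbackProj {X : Space.{u, v} B} {Y : Space.{u, w} B} (f g : Map X Y) :
    Map (pathPullback f g) X where
  toMap := ⟨fun z => z.1.1, by fun_prop⟩
  isFibrewisePointed := ⟨fun _ => rfl, fun _ => rfl⟩

/-- Fibrewise pointed cohomology `H_B^*(X) = H^*(X, s_X(B); R)`. -/
abbrev FibCohomology (R : Type*) [CommRing R] (X : Space.{u, v} B) : Type _ :=
  TotalCohomology R X (Set.range X.sec)

theorem Map.mapsTo {X : Space.{u, v} B} {Y : Space.{u, w} B} (f : Map X Y) :
    Set.MapsTo f.toMap (Set.range X.sec) (Set.range Y.sec) := by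
  rintro _ ⟨b, rfl⟩
  exact ⟨b, (f.isFibrewisePointed.2 b).symm⟩

/-- The induced ring homomorphism `f^* : H_B^*(Y) → H_B^*(X)`. -/
def Map.pullback (R : Type*) [CommRing R] {X : Space.{u, v} B} {Y : Space.{u, w} B}
    (f : Map X Y) : FibCohomology R Y →ₙ+* FibCohomology R X :=
  totalCohomologyMap R f.toMap f.mapsTo

end FibrewisePointed

end

open FibrewisePointed

noncomputable section

namespace FibrewisePointed

/-! ### Cochains on tuples of points -/

section Tuples

variable {R : Type*} [CommRing R] {V W V' W' : Type*}

/-! This is the cup-length argument, run relative to the section. If `π ∘ s` is homotopic to the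
inclusion of `U` through fibrewise pointed maps, restriction to `U` factors through `π^*`, so a
class in the kernel of `π^*` restricts to zero on `U` relative to the section. Extending a primitive
of the restriction by zero and subtracting its coboundary gives a representative that vanishes on
every simplex inside `U` (`mem_vanishingClasses_of_cohomologyMap_eq_zero`). For `n + 1` such classes
and a cover by `n + 1` open sets, the product of these representatives vanishes on every simplex
lying in some member of the cover (`mulSeq_mem_totalVanishingClasses`). Such a cocycle is a relative
coboundary (`mem_coboundaries_of_mem_smallCochains`), so the product is zero.

The last fact comes from subdivision. With `S` the dual of barycentric subdivision and `T` its
homotopy to the identity, a cocycle satisfies `δ T φ = φ - S φ`. By the Lebesgue number lemma, on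
each simplex only finitely many terms of `∑ T (S ^ k φ)` survive, and the coboundary of the sum
telescopes to `φ`. Both `T` and the prism operator behind homotopy invariance come from one
construction on tuples of points, where coning at a point is a contracting homotopy
(`tupleHomotopy_tupleCoboundary`).

The second statement reduces to the first: a fibrewise pointed homotopy from `f` to `g` over `U`,
read as a family of paths, is a strict section of the pullback over `U`
(`exists_section_of_homotopic`). -/

/-- Functions on the `m`-tuples of points of `V`: cochains of degree `m - 1` on the full simplex
with vertices `V`, with augmentation. -/
abbrev TupleCochain (R : Type*) (V : Type*) (m : ℕ) : Type _ := (Fin m → V) → R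

/-- The coboundary of cochains on tuples. -/
def tupleCoboundary (m : ℕ) : TupleCochain R V m →ₗ[R] TupleCochain R V (m + 1) where
  toFun Φ w := ∑ i : Fin (m + 1), (-1) ^ (i : ℕ) * Φ (w ∘ i.succAbove)
  map_add' Φ Ψ := by
    ext w
    simp [mul_add, Finset.sum_add_distrib]
  map_smul' c Φ := by
    ext w
    simp [Finset.mul_sum, mul_left_comm]

theorem tupleCoboundary_apply {m : ℕ} (Φ : TupleCochain R V m) (w : Fin (m + 1) → V) :
    tupleCoboundary m Φ w = ∑ i : Fin (m + 1), (-1) ^ (i : ℕ) * Φ (w ∘ i.succAbove) := rfl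

/-- The dual of coning off tuples at the point `b`. -/
def tupleCone (b : V) (m : ℕ) : TupleCochain R V (m + 1) →ₗ[R] TupleCochain R V m where
  toFun Φ v := Φ (Fin.cons b v)
  map_add' _ _ := rfl
  map_smul' _ _ := rfl

theorem tupleCone_apply (b : V) {m : ℕ} (Φ : TupleCochain R V (m + 1)) (v : Fin m → V) :
    tupleCone b m Φ v = Φ (Fin.cons b v) := rfl

/-- Pullback of cochains on tuples along a map of points. -/
def tuplePull (f : V → W) (m : ℕ) : TupleCochain R W m →ₗ[R] TupleCochain R V m where
  toFun Φ v := Φ (f ∘ v)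
  map_add' _ _ := rfl
  map_smul' _ _ := rfl

theorem tuplePull_apply (f : V → W) {m : ℕ} (Φ : TupleCochain R W m) (v : Fin m → V) :
    tuplePull f m Φ v = Φ (f ∘ v) := rfl

theorem tuplePull_tupleCoboundary (f : V → W) {m : ℕ} (Φ : TupleCochain R W m) :
    tuplePull f (m + 1) (tupleCoboundary m Φ) = tupleCoboundary m (tuplePull f m Φ) := rfl

theorem tupleCone_tuplePull (f : V → W) (b : V) {m : ℕ} (Φ : TupleCochain R W (m + 1)) :
    tupleCone b m (tuplePull f (m + 1) Φ) = tuplePull f m (tupleCone (f b) m Φ) := by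
  ext v
  exact congrArg Φ (Fin.comp_cons f b v)

theorem tupleCone_tupleCoboundary_zero (b : V) (Φ : TupleCochain R V 0) :
    tupleCone b 0 (tupleCoboundary 0 Φ) = Φ := by
  ext v
  simp only [tupleCone_apply, tupleCoboundary_apply, Fin.sum_univ_succ, Fin.sum_univ_zero]
  simp [Subsingleton.elim _ v]

/-- Deleting the apex of a cone leaves its base, and every other face is the cone on a face of the
base, with opposite sign. Thus coning is a contracting homotopy. -/
theorem tupleCone_tupleCoboundary (b : V) {m : ℕ} (Φ : TupleCochain R V (m + 1)) :
    tupleCone b (m + 1) (tupleCoboundary (m + 1) Φ) =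
      Φ - tupleCoboundary m (tupleCone b m Φ) := by
  ext v
  have h0 : (Fin.cons b v : Fin (m + 2) → V) ∘ (0 : Fin (m + 2)).succAbove = v := by
    funext j
    simp
  have h1 : ∀ i : Fin (m + 1), (Fin.cons b v : Fin (m + 2) → V) ∘ i.succ.succAbove =
      Fin.cons b (v ∘ i.succAbove) := by
    intro i
    funext j
    refine Fin.cases ?_ (fun j => ?_) j <;> simp
  simp only [tupleCone_apply, tupleCoboundary_apply, Pi.sub_apply]
  rw [Fin.sum_univ_succ, h0]
  simp only [h1, Fin.val_zero, Fin.val_succ, pow_succ, pow_zero, one_mul, mul_neg, mul_one,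
    neg_mul, Finset.sum_neg_distrib, sub_eq_add_neg]

/-- Every nonempty tuple is the cone from its first entry on the rest, so identities can be checked
after coning, which lowers the degree for inductions. -/
theorem tupleCochain_ext_cone {m : ℕ} {Φ Ψ : TupleCochain R V (m + 1)}
    (h : ∀ b, tupleCone b m Φ = tupleCone b m Ψ) : Φ = Ψ := by
  ext w
  rw [← Fin.cons_self_tail w]
  exact congrFun (h (w 0)) _

theorem tupleCoboundary_tupleCoboundary {m : ℕ} (Φ : TupleCochain R V m) :
    tupleCoboundary (m + 1) (tupleCoboundary m Φ) = 0 := by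
  induction m with
  | zero =>
    refine tupleCochain_ext_cone fun b => ?_
    rw [tupleCone_tupleCoboundary, tupleCone_tupleCoboundary_zero, sub_self, map_zero]
  | succ m ih =>
    refine tupleCochain_ext_cone fun b => ?_
    rw [tupleCone_tupleCoboundary, tupleCone_tupleCoboundary, map_sub, ih, sub_zero, sub_self,
      map_zero]

/-! ### Homotopies obtained by coning -/

/-- The homotopy between two families of chain maps `F` and `G`, given dually on tuples by the
recursion `H w = b w * (F w - G w - H (∂ w))`, where `*` is the cone construction. -/
def tupleHomotopy (F G : ∀ m, TupleCochain R W m →ₗ[R] TupleCochain R V m)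
    (b : ∀ m, (Fin (m + 1) → V) → W) : ∀ m, TupleCochain R W (m + 1) →ₗ[R] TupleCochain R V m
  | 0 => 0
  | m + 1 => LinearMap.pi fun w => LinearMap.proj w ∘ₗ
      (F (m + 1) - G (m + 1) - tupleCoboundary m ∘ₗ tupleHomotopy F G b m) ∘ₗ
        tupleCone (b m w) (m + 1)

theorem tupleHomotopy_succ_apply (F G : ∀ m, TupleCochain R W m →ₗ[R] TupleCochain R V m)
    (b : ∀ m, (Fin (m + 1) → V) → W) {m : ℕ} (Φ : TupleCochain R W (m + 2))
    (w : Fin (m + 1) → V) :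
    tupleHomotopy F G b (m + 1) Φ w =
      (F (m + 1) (tupleCone (b m w) (m + 1) Φ) - G (m + 1) (tupleCone (b m w) (m + 1) Φ) -
        tupleCoboundary m (tupleHomotopy F G b m (tupleCone (b m w) (m + 1) Φ))) w := rfl

/-- The acyclic-models argument made explicit. Agreement of `F` and `G` on the empty tuple, the
augmentation, starts the recursion. -/
theorem tupleHomotopy_tupleCoboundary
    {F G : ∀ m, TupleCochain R W m →ₗ[R] TupleCochain R V m}
    (hF : ∀ m Φ, F (m + 1) (tupleCoboundary m Φ) = tupleCoboundary m (F m Φ))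
    (hG : ∀ m Φ, G (m + 1) (tupleCoboundary m Φ) = tupleCoboundary m (G m Φ))
    (h0 : F 0 = G 0) (b : ∀ m, (Fin (m + 1) → V) → W) {m : ℕ} (Φ : TupleCochain R W (m + 1)) :
    tupleHomotopy F G b (m + 1) (tupleCoboundary (m + 1) Φ) +
      tupleCoboundary m (tupleHomotopy F G b m Φ) = F (m + 1) Φ - G (m + 1) Φ := by
  -- This is the error term left by coning `δ Φ`. It is `δ` applied to `F c - G c - H (δ c)`, which
  -- is `δ (H c)` by the homotopy identity one degree lower, so it dies by `δ ∘ δ = 0`.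
  have key : ∀ c : TupleCochain R W m, F (m + 1) (tupleCoboundary m c) -
      G (m + 1) (tupleCoboundary m c) -
      tupleCoboundary m (tupleHomotopy F G b m (tupleCoboundary m c)) = 0 := by
    intro c
    rw [hF, hG]
    induction m with
    | zero => simp [h0, tupleHomotopy]
    | succ m ih =>
      have h1 : ∀ Φ : TupleCochain R W (m + 1),
          tupleHomotopy F G b (m + 1) (tupleCoboundary (m + 1) Φ) +
            tupleCoboundary m (tupleHomotopy F G b m Φ) = F (m + 1) Φ - G (m + 1) Φ := by
        intro Φ
        ext w
        have h2 := congrFun (ih Φ (tupleCone (b m w) m Φ)) w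
        rw [Pi.add_apply, tupleHomotopy_succ_apply, tupleCone_tupleCoboundary]
        simp only [map_sub, Pi.sub_apply, Pi.zero_apply, hF, hG] at h2 ⊢
        linear_combination -h2
      rw [eq_sub_of_add_eq (h1 c), map_sub, map_sub, tupleCoboundary_tupleCoboundary]
      simp
  ext w
  have h2 := congrFun (key (tupleCone (b m w) m Φ)) w
  rw [Pi.add_apply, tupleHomotopy_succ_apply, tupleCone_tupleCoboundary]
  simp only [map_sub, Pi.sub_apply, Pi.zero_apply] at h2 ⊢
  linear_combination -h2

/-- The recursion depends only on `F`, `G` and the apexes, so compatibility of these passes to the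
homotopy. This makes it possible to restrict the operators to faces. -/
theorem tuplePull_tupleHomotopy {F G : ∀ m, TupleCochain R W m →ₗ[R] TupleCochain R V m}
    {F' G' : ∀ m, TupleCochain R W' m →ₗ[R] TupleCochain R V' m}
    {b : ∀ m, (Fin (m + 1) → V) → W} {b' : ∀ m, (Fin (m + 1) → V') → W'}
    {f : V → V'} {g : W → W'}
    (hF : ∀ m Φ, tuplePull f m (F' m Φ) = F m (tuplePull g m Φ))
    (hG : ∀ m Φ, tuplePull f m (G' m Φ) = G m (tuplePull g m Φ))
    (hb : ∀ m w, g (b m w) = b' m (f ∘ w)) (m : ℕ) (Φ : TupleCochain R W' (m + 1)) :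
    tuplePull f m (tupleHomotopy F' G' b' m Φ) =
      tupleHomotopy F G b m (tuplePull g (m + 1) Φ) := by
  induction m with
  | zero => rfl
  | succ m ih =>
    ext w
    rw [tupleHomotopy_succ_apply, tupleCone_tuplePull, hb, ← hF, ← hG, ← ih,
      ← tuplePull_tupleCoboundary]
    rfl

/-! ### Subdivision of tuples and its mesh -/

/-- Barycentric subdivision of tuples, given dually by the recursion `S w = b w * S (∂ w)`, where
`*` is the cone construction. -/
def tupleSubdivision (b : ∀ m, (Fin (m + 1) → V) → V) :
    ∀ m, TupleCochain R V m →ₗ[R] TupleCochain R V m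
  | 0 => LinearMap.id
  | m + 1 => LinearMap.pi fun w => LinearMap.proj w ∘ₗ
      (tupleCoboundary m ∘ₗ tupleSubdivision b m) ∘ₗ tupleCone (b m w) m

theorem tupleSubdivision_succ_apply (b : ∀ m, (Fin (m + 1) → V) → V) {m : ℕ}
    (Φ : TupleCochain R V (m + 1)) (w : Fin (m + 1) → V) :
    tupleSubdivision b (m + 1) Φ w =
      tupleCoboundary m (tupleSubdivision b m (tupleCone (b m w) m Φ)) w := rfl

theorem tupleSubdivision_tupleCoboundary (b : ∀ m, (Fin (m + 1) → V) → V) (m : ℕ)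
    (Φ : TupleCochain R V m) :
    tupleSubdivision b (m + 1) (tupleCoboundary m Φ) =
      tupleCoboundary m (tupleSubdivision b m Φ) := by
  induction m with
  | zero =>
    ext w
    rw [tupleSubdivision_succ_apply, tupleCone_tupleCoboundary_zero]
  | succ m ih =>
    ext w
    rw [tupleSubdivision_succ_apply, tupleCone_tupleCoboundary, map_sub, ih, map_sub,
      tupleCoboundary_tupleCoboundary, sub_zero]

theorem tuplePull_tupleSubdivision {b : ∀ m, (Fin (m + 1) → V) → V}
    {b' : ∀ m, (Fin (m + 1) → V') → V'} {f : V → V'}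
    (hb : ∀ m w, f (b m w) = b' m (f ∘ w)) (m : ℕ) (Φ : TupleCochain R V' m) :
    tuplePull f m (tupleSubdivision b' m Φ) = tupleSubdivision b m (tuplePull f m Φ) := by
  induction m with
  | zero => rfl
  | succ m ih =>
    ext w
    rw [tupleSubdivision_succ_apply, tupleCone_tuplePull, hb, ← ih, ← tuplePull_tupleCoboundary]
    rfl

/-- If the points `b` are close to all vertices of their tuples, then the subdivision of a tuple
only involves tuples of small diameter. -/
theorem tupleSubdivision_apply_eq_zero [PseudoMetricSpace V] {b : ∀ m, (Fin (m + 1) → V) → V}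
    {N : ℕ} {c : ℝ}
    (hb : ∀ k < N, ∀ (v : Fin (k + 1) → V) (d : ℝ), (∀ i j, dist (v i) (v j) ≤ d) →
      ∀ i, dist (v i) (b k v) ≤ c * d)
    (hball : ∀ (x : V) (r : ℝ) (k : ℕ) (v : Fin (k + 1) → V), (∀ i, dist (v i) x ≤ r) →
      dist (b k v) x ≤ r)
    {m : ℕ} (hm : m ≤ N) {K : Set V}
    (hK : ∀ (k : ℕ) (v : Fin (k + 1) → V), (∀ i, v i ∈ K) → b k v ∈ K)
    {Φ : TupleCochain R V m} {w : Fin m → V} {d : ℝ} (hw : ∀ i, w i ∈ K)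
    (hd : ∀ i j, dist (w i) (w j) ≤ d)
    (hΦ : ∀ v : Fin m → V, (∀ i, v i ∈ K) → (∀ i j, dist (v i) (v j) ≤ c * d) → Φ v = 0) :
    tupleSubdivision b m Φ w = 0 := by
  induction m generalizing K with
  | zero => exact hΦ w hw fun i => i.elim0
  | succ m ih =>
    have h1 := hb m hm w d hd
    rw [tupleSubdivision_succ_apply, tupleCoboundary_apply]
    refine Finset.sum_eq_zero fun i _ => ?_
    -- Shrinking `K` to a ball around the apex records that all subdivided tuples of the faces stay
    -- within `c * d` of it; this bounds the new edges created by the cone.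
    refine mul_eq_zero_of_right _ (ih (by omega) (K := K ∩ {x | dist x (b m w) ≤ c * d})
      (fun k v hv => ⟨hK k v fun j => (hv j).1, hball _ _ _ _ fun j => (hv j).2⟩)
      (fun j => ⟨hw _, h1 _⟩) (fun j l => hd _ _) fun v hv hv' => ?_)
    refine hΦ _ (fun j => ?_) fun j l => ?_
    · refine Fin.cases ?_ (fun j => ?_) j
      · exact hK m w hw
      · exact (hv j).1
    · refine Fin.cases ?_ (fun j => ?_) j <;> refine Fin.cases ?_ (fun l => ?_) l
      · simpa using dist_nonneg.trans (h1 0)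
      · simpa [dist_comm] using (hv l).2
      · simpa using (hv j).2
      · simpa using hv' j l

theorem tupleSubdivision_pow_apply_eq_zero [PseudoMetricSpace V]
    {b : ∀ m, (Fin (m + 1) → V) → V} {N : ℕ} {c : ℝ}
    (hb : ∀ k < N, ∀ (v : Fin (k + 1) → V) (d : ℝ), (∀ i j, dist (v i) (v j) ≤ d) →
      ∀ i, dist (v i) (b k v) ≤ c * d)
    (hball : ∀ (x : V) (r : ℝ) (k : ℕ) (v : Fin (k + 1) → V), (∀ i, dist (v i) x ≤ r) →
      dist (b k v) x ≤ r)
    {m : ℕ} (hm : m ≤ N) {Φ : TupleCochain R V m} (k : ℕ) {w : Fin m → V} {d : ℝ}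
    (hd : ∀ i j, dist (w i) (w j) ≤ d)
    (hΦ : ∀ v : Fin m → V, (∀ i j, dist (v i) (v j) ≤ c ^ k * d) → Φ v = 0) :
    (tupleSubdivision b m ^ k) Φ w = 0 := by
  induction k generalizing w d with
  | zero => exact hΦ w (by simpa using hd)
  | succ k ih =>
    rw [pow_succ', Module.End.mul_apply]
    refine tupleSubdivision_apply_eq_zero hb hball hm (K := Set.univ) (by simp) (by simp) hd
      fun v _ hv => ih hv fun u hu => hΦ u ?_
    simpa only [pow_succ, mul_assoc] using hu

end Tuples

/-! ### Homotopy invariance -/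

section Prism

variable {R : Type*} [CommRing R] {X Y : Type*} [TopologicalSpace X] [TopologicalSpace Y]

/-- The affine map from a simplex to the unit interval with prescribed values at the vertices. -/
def intervalSimplex {m : ℕ} (e : Fin (m + 1) → Fin 2) :
    C(stdSimplex ℝ (Fin (m + 1)), unitInterval) :=
  (ContinuousMap.mk _ stdSimplexHomeomorphUnitInterval.continuous).comp (vertexMap (n := 1) e)

theorem coboundary_apply {n : ℕ} (φ : Cochain R X n) (σ : Simplex X (n + 1)) :
    coboundary X n φ σ = ∑ i : Fin (n + 2), (-1) ^ (i : ℕ) * φ (σ.pull i.succAbove) := rfl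

theorem vertexMap_comp_vertexMap {l m n : ℕ} (a : Fin (l + 1) → Fin (m + 1))
    (b : Fin (m + 1) → Fin (n + 1)) : (vertexMap b).comp (vertexMap a) = vertexMap (b ∘ a) := by
  ext1 x
  exact stdSimplex.map_comp_apply a b x

theorem intervalSimplex_comp_vertexMap {l m : ℕ} (a : Fin (l + 1) → Fin (m + 1))
    (e : Fin (m + 1) → Fin 2) :
    (intervalSimplex e).comp (vertexMap a) = intervalSimplex (e ∘ a) := by
  rw [intervalSimplex, ContinuousMap.comp_assoc]
  exact congrArg _ (vertexMap_comp_vertexMap (n := 1) a e)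

theorem intervalSimplex_zero {m : ℕ} (t : stdSimplex ℝ (Fin (m + 1))) :
    intervalSimplex (fun _ => 0) t = 0 := by
  apply Subtype.ext
  change (stdSimplex.map (fun _ => (0 : Fin 2)) t : Fin 2 → ℝ) 1 = 0
  simp [FunOnFinite.linearMap_apply_apply]

theorem intervalSimplex_one {m : ℕ} (t : stdSimplex ℝ (Fin (m + 1))) :
    intervalSimplex (fun _ => 1) t = 1 := by
  apply Subtype.ext
  change (stdSimplex.map (fun _ => (1 : Fin 2)) t : Fin 2 → ℝ) 1 = 1
  simp [FunOnFinite.linearMap_apply_apply]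

/-- The simplex of `Y` obtained from a homotopy and an affine simplex of the prism over a simplex
of `X`, the latter being given by its vertices. -/
def prismSimplex (H : C(unitInterval × X, Y)) {n : ℕ} (σ : Simplex X n) {m : ℕ}
    (w : Fin (m + 1) → Fin 2 × Fin (n + 1)) : Simplex Y m :=
  H.comp ((intervalSimplex (Prod.fst ∘ w)).prodMk (σ.pull (Prod.snd ∘ w)))

theorem pull_prismSimplex (H : C(unitInterval × X, Y)) {n : ℕ} (σ : Simplex X n) {l m : ℕ}
    (w : Fin (m + 1) → Fin 2 × Fin (n + 1)) (a : Fin (l + 1) → Fin (m + 1)) :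
    (prismSimplex H σ w).pull a = prismSimplex H σ (w ∘ a) := by
  have h1 := intervalSimplex_comp_vertexMap a (Prod.fst ∘ w)
  have h2 := σ.pull_pull a (Prod.snd ∘ w)
  ext t
  exact congrArg H (Prod.ext (DFunLike.congr_fun h1 t) (DFunLike.congr_fun h2 t))

theorem prismSimplex_pull (H : C(unitInterval × X, Y)) {n k : ℕ} (σ : Simplex X n) {m : ℕ}
    (a : Fin (k + 1) → Fin (n + 1)) (w : Fin (m + 1) → Fin 2 × Fin (k + 1)) :
    prismSimplex H (σ.pull a) w = prismSimplex H σ (Prod.map id a ∘ w) := by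
  have h2 := σ.pull_pull (Prod.snd ∘ w) a
  ext t
  exact congrArg H (Prod.ext rfl (DFunLike.congr_fun h2 t))

/-- The cochain on tuples of vertices of a prism induced by a cochain of `Y`. -/
def prismCochain (H : C(unitInterval × X, Y)) {n : ℕ} (σ : Simplex X n) {m : ℕ}
    (φ : Cochain R Y m) : TupleCochain R (Fin 2 × Fin (n + 1)) (m + 1) :=
  fun w => φ (prismSimplex H σ w)

theorem tupleCoboundary_prismCochain (H : C(unitInterval × X, Y)) {n : ℕ} (σ : Simplex X n)
    {m : ℕ} (φ : Cochain R Y m) :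
    tupleCoboundary (m + 1) (prismCochain H σ φ) = prismCochain H σ (coboundary Y m φ) := by
  ext w
  rw [tupleCoboundary_apply, prismCochain, coboundary_apply]
  exact Finset.sum_congr rfl fun i _ => by rw [pull_prismSimplex]; rfl

theorem tuplePull_prismCochain (H : C(unitInterval × X, Y)) {n k : ℕ} (σ : Simplex X n)
    (a : Fin (k + 1) → Fin (n + 1)) {m : ℕ} (φ : Cochain R Y m) :
    tuplePull (Prod.map id a) (m + 1) (prismCochain H σ φ) = prismCochain H (σ.pull a) φ := by
  ext w
  exact congrArg φ (prismSimplex_pull H σ a w).symm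

/-- The prism operator on tuples. -/
def tuplePrism (V : Type*) (m : ℕ) :
    TupleCochain R (Fin 2 × V) (m + 1) →ₗ[R] TupleCochain R V m :=
  tupleHomotopy (tuplePull (Prod.mk 1)) (tuplePull (Prod.mk 0)) (fun _ w => (0, w 0)) m

theorem tuplePrism_tupleCoboundary {V : Type*} {m : ℕ}
    (Φ : TupleCochain R (Fin 2 × V) (m + 1)) :
    tuplePrism V (m + 1) (tupleCoboundary (m + 1) Φ) + tupleCoboundary m (tuplePrism V m Φ) =
      tuplePull (Prod.mk 1) (m + 1) Φ - tuplePull (Prod.mk 0) (m + 1) Φ :=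
  -- The two end inclusions agree in augmented degree because there is only one empty tuple.
  tupleHomotopy_tupleCoboundary (fun _ _ => rfl) (fun _ _ => rfl)
    (LinearMap.ext fun Φ => funext fun _ => congrArg Φ (Subsingleton.elim _ _)) _ Φ

theorem tuplePull_tuplePrism {V W : Type*} (f : V → W) (m : ℕ)
    (Φ : TupleCochain R (Fin 2 × W) (m + 1)) :
    tuplePull f m (tuplePrism W m Φ) = tuplePrism V m (tuplePull (Prod.map id f) (m + 1) Φ) :=
  tuplePull_tupleHomotopy (f := f) (g := Prod.map id f) (fun _ _ => rfl) (fun _ _ => rfl)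
    (fun _ _ => rfl) m Φ

/-- The prism operator of a homotopy. -/
def prism (H : C(unitInterval × X, Y)) (n : ℕ) (φ : Cochain R Y (n + 1)) : Cochain R X n :=
  fun σ => tuplePrism (Fin (n + 1)) (n + 1) (prismCochain H σ φ) id

theorem Simplex.pull_id {n : ℕ} (σ : Simplex X n) : σ.pull id = σ := by
  ext t
  exact congrArg σ (stdSimplex.map_id_apply t)

theorem prismSimplex_eq_comp {f g : C(X, Y)} (H : f.Homotopy g) {n : ℕ} (σ : Simplex X n) :
    prismSimplex H.toContinuousMap σ (Prod.mk 0) = f.comp σ ∧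
      prismSimplex H.toContinuousMap σ (Prod.mk 1) = g.comp σ := by
  constructor <;> ext t
  · have h : prismSimplex H.toContinuousMap σ (Prod.mk 0) t =
        H (intervalSimplex (fun _ => 0) t, σ.pull id t) := rfl
    rw [h, intervalSimplex_zero, Simplex.pull_id, H.apply_zero]
    rfl
  · have h : prismSimplex H.toContinuousMap σ (Prod.mk 1) t =
        H (intervalSimplex (fun _ => 1) t, σ.pull id t) := rfl
    rw [h, intervalSimplex_one, Simplex.pull_id, H.apply_one]
    rfl

theorem pullCochain_sub_pullCochain_zero {f g : C(X, Y)} (H : f.Homotopy g)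
    {φ : Cochain R Y 0} (hφ : coboundary Y 0 φ = 0) :
    pullCochain g 0 φ = pullCochain f 0 φ := by
  ext σ
  have h1 := congrFun (tuplePrism_tupleCoboundary (prismCochain H.toContinuousMap σ φ)) id
  rw [tupleCoboundary_prismCochain, hφ] at h1
  -- On tuples of length one the homotopy is zero by definition, so no correction term remains.
  change tuplePrism _ _ 0 id + tupleCoboundary 0 0 id =
    φ (prismSimplex _ σ (Prod.mk 1)) - φ (prismSimplex _ σ (Prod.mk 0)) at h1
  rw [(prismSimplex_eq_comp H σ).1, (prismSimplex_eq_comp H σ).2] at h1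
  simp only [map_zero, Pi.zero_apply, add_zero] at h1
  exact (sub_eq_zero.1 h1.symm)

theorem coboundary_prism {f g : C(X, Y)} (H : f.Homotopy g) {n : ℕ}
    {φ : Cochain R Y (n + 1)} (hφ : coboundary Y (n + 1) φ = 0) :
    coboundary X n (prism H.toContinuousMap n φ) =
      pullCochain g (n + 1) φ - pullCochain f (n + 1) φ := by
  ext σ
  have h1 := congrFun (tuplePrism_tupleCoboundary (prismCochain H.toContinuousMap σ φ)) id
  rw [tupleCoboundary_prismCochain, hφ] at h1
  change tuplePrism _ _ 0 id + _ =
    φ (prismSimplex _ σ (Prod.mk 1)) - φ (prismSimplex _ σ (Prod.mk 0)) at h1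
  rw [(prismSimplex_eq_comp H σ).1, (prismSimplex_eq_comp H σ).2, map_zero, Pi.zero_apply,
    zero_add] at h1
  refine Eq.trans ?_ h1
  rw [coboundary_apply, tupleCoboundary_apply]
  refine Finset.sum_congr rfl fun i _ => ?_
  -- By naturality the prism over a face of `σ` is computed inside the prism over `σ`, so the
  -- singular coboundary becomes the coboundary on tuples.
  rw [prism, ← tuplePull_prismCochain, ← tuplePull_tuplePrism]
  rfl

variable {A : Set X} {A' : Set Y}

theorem prism_mem_relCochains {H : C(unitInterval × X, Y)}
    (hH : ∀ t, ∀ x ∈ A, H (t, x) ∈ A') {n : ℕ} {φ : Cochain R Y (n + 1)}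
    (hφ : φ ∈ relCochains R Y A' (n + 1)) : prism H n φ ∈ relCochains R X A n := by
  intro σ hσ
  have h0 : prismCochain H σ φ = 0 := by
    ext w
    refine hφ _ ?_
    rintro _ ⟨t, rfl⟩
    exact hH _ _ (hσ (σ.range_pull _ ⟨t, rfl⟩))
  rw [prism, h0, map_zero, Pi.zero_apply]

/-- Homotopy invariance of relative singular cohomology. -/
theorem cohomologyMap_eq_of_homotopy {f g : C(X, Y)} (hf : Set.MapsTo f A A')
    (hg : Set.MapsTo g A A') (H : f.Homotopy g) (hH : ∀ t, ∀ x ∈ A, H (t, x) ∈ A') (n : ℕ) :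
    cohomologyMap (R := R) f hf n = cohomologyMap g hg n := by
  ext a
  obtain ⟨φ, rfl⟩ := cls_surjective n a
  -- The sign is flipped because the prism operator produces `g` minus `f`.
  rw [← sub_eq_zero, ← neg_eq_zero, neg_sub]
  refine (map_sub (cls n) _ _).symm.trans (cls_eq_zero ?_)
  change pullCochain g n φ - pullCochain f n φ ∈ coboundaries R X A n
  have h1 : coboundary Y n (φ : Cochain R Y n) = 0 := φ.2.2
  cases n with
  | zero =>
    rw [pullCochain_sub_pullCochain_zero H h1, sub_self]
    exact zero_mem _
  | succ n => exact ⟨_, prism_mem_relCochains hH φ.2.1, coboundary_prism H h1⟩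

end Prism

/-! ### Subdivision of singular cochains -/

section Subdivision

variable {R : Type*} [CommRing R] {X : Type*} [TopologicalSpace X]

/-- The affine simplex of a standard simplex with given vertices. -/
def affineSimplex {m n : ℕ} (w : Fin (m + 1) → stdSimplex ℝ (Fin (n + 1))) :
    C(stdSimplex ℝ (Fin (m + 1)), stdSimplex ℝ (Fin (n + 1))) where
  toFun t := ⟨∑ i, t.1 i • (w i).1, (convex_stdSimplex ℝ _).sum_mem (fun i _ => t.2.1 i) t.2.2
    fun i _ => (w i).2⟩
  continuous_toFun := by
    refine Continuous.subtype_mk ?_ _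
    exact continuous_finsetSum _ fun i _ =>
      ((continuous_apply i).comp continuous_subtype_val).smul continuous_const

theorem affineSimplex_val {m n : ℕ} (w : Fin (m + 1) → stdSimplex ℝ (Fin (n + 1)))
    (t : stdSimplex ℝ (Fin (m + 1))) : (affineSimplex w t).1 = ∑ i, t.1 i • (w i).1 := rfl

theorem affineSimplex_affineSimplex {l m n : ℕ} (w : Fin (m + 1) → stdSimplex ℝ (Fin (n + 1)))
    (v : Fin (l + 1) → stdSimplex ℝ (Fin (m + 1))) (t : stdSimplex ℝ (Fin (l + 1))) :
    affineSimplex w (affineSimplex v t) = affineSimplex (affineSimplex w ∘ v) t := by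
  apply Subtype.ext
  simp only [affineSimplex_val, Function.comp_apply, Finset.sum_apply, Pi.smul_apply,
    Finset.smul_sum, Finset.sum_smul, smul_smul, smul_eq_mul]
  exact Finset.sum_comm

theorem affineSimplex_vertex {m n : ℕ} (w : Fin (m + 1) → stdSimplex ℝ (Fin (n + 1)))
    (i : Fin (m + 1)) : affineSimplex w (stdSimplex.vertex i) = w i := by
  apply Subtype.ext
  rw [affineSimplex_val, Finset.sum_eq_single i]
  · simp
  · intro j _ hj
    simp [hj]
  · simp

theorem affineSimplex_comp_vertex {m n : ℕ} (w : Fin (m + 1) → stdSimplex ℝ (Fin (n + 1))) :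
    affineSimplex w ∘ stdSimplex.vertex = w :=
  funext (affineSimplex_vertex w)

theorem affineSimplex_vertex_comp {m n : ℕ} (a : Fin (m + 1) → Fin (n + 1)) :
    affineSimplex (stdSimplex.vertex ∘ a) = vertexMap a := by
  ext t j
  change (affineSimplex (stdSimplex.vertex ∘ a) t).1 j = FunOnFinite.linearMap ℝ ℝ a t j
  rw [affineSimplex_val, FunOnFinite.linearMap_apply_apply, Finset.sum_apply, Finset.sum_filter]
  refine Finset.sum_congr rfl fun i _ => ?_
  by_cases h : a i = j
  · subst h
    simp
    rfl
  · simp [h, Ne.symm h]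

theorem affineSimplex_comp_vertexMap {l m n : ℕ}
    (w : Fin (m + 1) → stdSimplex ℝ (Fin (n + 1))) (a : Fin (l + 1) → Fin (m + 1)) :
    (affineSimplex w).comp (vertexMap a) = affineSimplex (w ∘ a) := by
  ext1 t
  rw [← affineSimplex_vertex_comp, ContinuousMap.comp_apply, affineSimplex_affineSimplex]
  congr 2
  funext i
  exact affineSimplex_vertex w (a i)

/-- The barycenter of a tuple of points of a standard simplex. -/
def tupleBarycenter {n : ℕ} (m : ℕ) (w : Fin (m + 1) → stdSimplex ℝ (Fin (n + 1))) :
    stdSimplex ℝ (Fin (n + 1)) :=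
  affineSimplex w stdSimplex.barycenter

theorem affineSimplex_tupleBarycenter {k n : ℕ} (w : Fin (k + 1) → stdSimplex ℝ (Fin (n + 1)))
    (m : ℕ) (v : Fin (m + 1) → stdSimplex ℝ (Fin (k + 1))) :
    affineSimplex w (tupleBarycenter m v) = tupleBarycenter m (affineSimplex w ∘ v) :=
  affineSimplex_affineSimplex w v _

theorem dist_affineSimplex_le {m n : ℕ} {w : Fin (m + 1) → stdSimplex ℝ (Fin (n + 1))}
    {x : stdSimplex ℝ (Fin (n + 1))} {r : ℝ} (h : ∀ i, dist (w i) x ≤ r)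
    (t : stdSimplex ℝ (Fin (m + 1))) : dist (affineSimplex w t) x ≤ r :=
  (convex_closedBall x.1 r).sum_mem (fun i _ => t.2.1 i) t.2.2 fun i _ => h i

theorem dist_tupleBarycenter_le {n N : ℕ} :
    ∀ k < N, ∀ (v : Fin (k + 1) → stdSimplex ℝ (Fin (n + 1))) (d : ℝ),
      (∀ i j, dist (v i) (v j) ≤ d) →
        ∀ i, dist (v i) (tupleBarycenter k v) ≤ (N / (N + 1) : ℝ) * d := by
  intro k hk v d hd i
  have hd0 : 0 ≤ d := dist_nonneg.trans (hd i i)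
  have hk0 : (0 : ℝ) < k + 1 := by positivity
  have h1 : (tupleBarycenter k v).1 = ∑ j, (k + 1 : ℝ)⁻¹ • (v j).1 := by
    rw [tupleBarycenter, affineSimplex_val]
    refine Finset.sum_congr rfl fun j _ => ?_
    congr 1
    change ((Fintype.card (Fin (k + 1)) : ℝ))⁻¹ = _
    simp
  have h2 : (tupleBarycenter k v).1 - (v i).1 = ∑ j, (k + 1 : ℝ)⁻¹ • ((v j).1 - (v i).1) := by
    rw [h1]
    simp only [smul_sub, Finset.sum_sub_distrib, Finset.sum_const, Finset.card_univ,
      Fintype.card_fin]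
    congr 1
    rw [← Nat.cast_smul_eq_nsmul ℝ, smul_smul]
    push_cast
    rw [mul_inv_cancel₀ hk0.ne', one_smul]
  rw [dist_comm]
  change dist (tupleBarycenter k v).1 (v i).1 ≤ _
  -- The term of index `i` vanishes, leaving `k` terms of norm at most `d / (k + 1)`; then `k / (k +
  -- 1) ≤ N / (N + 1)`.
  rw [dist_eq_norm, h2, ← Finset.add_sum_erase _ _ (Finset.mem_univ i), sub_self, smul_zero,
    zero_add]
  have h3 : ∀ j ∈ Finset.univ.erase i, ‖(k + 1 : ℝ)⁻¹ • ((v j).1 - (v i).1)‖ ≤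
      (k + 1 : ℝ)⁻¹ * d := by
    intro j _
    rw [norm_smul, Real.norm_of_nonneg (by positivity), ← dist_eq_norm]
    exact mul_le_mul_of_nonneg_left (hd j i) (by positivity)
  refine (norm_sum_le_of_le _ h3).trans ?_
  rw [Finset.sum_const, Finset.card_erase_of_mem (Finset.mem_univ i), Finset.card_univ,
    Fintype.card_fin, nsmul_eq_mul, ← mul_assoc]
  refine mul_le_mul_of_nonneg_right ?_ hd0
  have hkN : (k : ℝ) ≤ N := by exact_mod_cast hk.le
  rw [Nat.add_sub_cancel, ← div_eq_mul_inv, div_le_div_iff₀ hk0 (by positivity)]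
  nlinarith

/-- The cochain on tuples of points of a standard simplex induced by a cochain of `X` and a simplex
of `X`. -/
def affinePull {n : ℕ} (σ : Simplex X n) (m : ℕ) :
    Cochain R X m →ₗ[R] TupleCochain R (stdSimplex ℝ (Fin (n + 1))) (m + 1) where
  toFun φ w := φ (σ.comp (affineSimplex w))
  map_add' _ _ := rfl
  map_smul' _ _ := rfl

theorem affinePull_apply {n : ℕ} (σ : Simplex X n) {m : ℕ} (φ : Cochain R X m)
    (w : Fin (m + 1) → stdSimplex ℝ (Fin (n + 1))) :
    affinePull σ m φ w = φ (σ.comp (affineSimplex w)) := rfl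

/-- The tuple of all vertices spans the identity simplex. Evaluating there transfers identities on
tuples to singular cochains. -/
theorem affinePull_vertex {n : ℕ} (σ : Simplex X n) (φ : Cochain R X n) :
    affinePull σ n φ stdSimplex.vertex = φ σ := by
  have h := affineSimplex_vertex_comp (id : Fin (n + 1) → Fin (n + 1))
  rw [Function.comp_id] at h
  rw [affinePull_apply, h]
  exact congrArg φ σ.pull_id

theorem tupleCoboundary_affinePull {n : ℕ} (σ : Simplex X n) {m : ℕ} (φ : Cochain R X m) :
    tupleCoboundary (m + 1) (affinePull σ m φ) = affinePull σ (m + 1) (coboundary X m φ) := by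
  ext w
  rw [tupleCoboundary_apply, affinePull_apply, coboundary_apply]
  refine Finset.sum_congr rfl fun i _ => ?_
  rw [affinePull_apply, Simplex.pull, ContinuousMap.comp_assoc, affineSimplex_comp_vertexMap]

theorem coboundary_coboundary {n : ℕ} (φ : Cochain R X n) :
    coboundary X (n + 1) (coboundary X n φ) = 0 := by
  ext σ
  rw [← affinePull_vertex σ (coboundary X (n + 1) _), ← tupleCoboundary_affinePull,
    ← tupleCoboundary_affinePull, tupleCoboundary_tupleCoboundary]
  rfl

theorem tuplePull_affinePull {k n : ℕ} (σ : Simplex X n)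
    (w : Fin (k + 1) → stdSimplex ℝ (Fin (n + 1))) {m : ℕ} (φ : Cochain R X m) :
    tuplePull (affineSimplex w) (m + 1) (affinePull σ m φ) =
      affinePull (σ.comp (affineSimplex w)) m φ := by
  ext v
  refine congrArg φ ?_
  ext t
  exact congrArg σ (affineSimplex_affineSimplex w v t).symm

/-- The subdivision operator on singular cochains. -/
def subdivision (m : ℕ) : Cochain R X m →ₗ[R] Cochain R X m :=
  LinearMap.pi fun σ => LinearMap.proj stdSimplex.vertex ∘ₗ
    tupleSubdivision tupleBarycenter (m + 1) ∘ₗ affinePull σ m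

/-- The homotopy between the identity of tuples and subdivision. -/
def tupleSubdivisionHomotopy {V : Type*} (b : ∀ m, (Fin (m + 1) → V) → V) (m : ℕ) :
    TupleCochain R V (m + 1) →ₗ[R] TupleCochain R V m :=
  tupleHomotopy (fun _ => LinearMap.id) (tupleSubdivision b) b m

/-- The homotopy between the identity of singular cochains and subdivision. -/
def subdivisionHomotopy (m : ℕ) : Cochain R X (m + 1) →ₗ[R] Cochain R X m :=
  LinearMap.pi fun σ => LinearMap.proj stdSimplex.vertex ∘ₗ
    tupleSubdivisionHomotopy tupleBarycenter (m + 1) ∘ₗ affinePull σ (m + 1)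

theorem subdivision_apply {m : ℕ} (φ : Cochain R X m) (σ : Simplex X m) :
    subdivision m φ σ =
      tupleSubdivision tupleBarycenter (m + 1) (affinePull σ m φ) stdSimplex.vertex := rfl

theorem subdivisionHomotopy_apply {m : ℕ} (φ : Cochain R X (m + 1)) (σ : Simplex X m) :
    subdivisionHomotopy m φ σ = tupleSubdivisionHomotopy tupleBarycenter (m + 1)
      (affinePull σ (m + 1) φ) stdSimplex.vertex := rfl

/-- Affine maps preserve barycenters, so subdividing the standard simplex and carrying it to `w` is
the same as subdividing `w`. Hence the operator can be iterated on tuples. -/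
theorem affinePull_subdivision {n : ℕ} (σ : Simplex X n) {m : ℕ} (φ : Cochain R X m) :
    affinePull σ m (subdivision m φ) =
      tupleSubdivision tupleBarycenter (m + 1) (affinePull σ m φ) := by
  ext w
  rw [affinePull_apply, subdivision_apply, ← tuplePull_affinePull,
    ← tuplePull_tupleSubdivision (affineSimplex_tupleBarycenter w),
    tuplePull_apply, affineSimplex_comp_vertex]

theorem affinePull_subdivisionHomotopy {n : ℕ} (σ : Simplex X n) {m : ℕ}
    (φ : Cochain R X (m + 1)) :
    affinePull σ m (subdivisionHomotopy m φ) =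
      tupleSubdivisionHomotopy tupleBarycenter (m + 1) (affinePull σ (m + 1) φ) := by
  ext w
  have h := tuplePull_tupleHomotopy (R := R) (F := fun _ => LinearMap.id)
    (F' := fun _ => LinearMap.id) (fun _ _ => rfl)
    (tuplePull_tupleSubdivision (affineSimplex_tupleBarycenter w))
    (affineSimplex_tupleBarycenter w) (m + 1) (affinePull σ (m + 1) φ)
  rw [affinePull_apply, subdivisionHomotopy_apply, ← tuplePull_affinePull,
    tupleSubdivisionHomotopy, tupleSubdivisionHomotopy, ← h,
    tuplePull_apply, affineSimplex_comp_vertex]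

theorem affinePull_subdivision_pow {n : ℕ} (σ : Simplex X n) {m : ℕ} (k : ℕ)
    (φ : Cochain R X m) :
    affinePull σ m ((subdivision m ^ k) φ) =
      (tupleSubdivision tupleBarycenter (m + 1) ^ k) (affinePull σ m φ) := by
  induction k with
  | zero => rfl
  | succ k ih => rw [pow_succ', pow_succ', Module.End.mul_apply, Module.End.mul_apply,
      affinePull_subdivision, ih]

theorem coboundary_subdivision {m : ℕ} (φ : Cochain R X m) :
    coboundary X m (subdivision m φ) = subdivision (m + 1) (coboundary X m φ) := by
  ext σ
  rw [← affinePull_vertex σ (coboundary X m _), ← affinePull_vertex σ (subdivision _ _),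
    ← tupleCoboundary_affinePull, affinePull_subdivision, affinePull_subdivision,
    ← tupleCoboundary_affinePull, tupleSubdivision_tupleCoboundary]

theorem coboundary_subdivision_pow {m : ℕ} {φ : Cochain R X m} (hφ : coboundary X m φ = 0)
    (k : ℕ) : coboundary X m ((subdivision m ^ k) φ) = 0 := by
  induction k with
  | zero => exact hφ
  | succ k ih => rw [pow_succ', Module.End.mul_apply, coboundary_subdivision, ih, map_zero]

theorem coboundary_subdivisionHomotopy {m : ℕ} {φ : Cochain R X (m + 1)}
    (hφ : coboundary X (m + 1) φ = 0) :
    coboundary X m (subdivisionHomotopy m φ) = φ - subdivision (m + 1) φ := by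
  ext σ
  have h := tupleHomotopy_tupleCoboundary (R := R) (F := fun _ => LinearMap.id)
    (fun _ _ => rfl) (tupleSubdivision_tupleCoboundary (tupleBarycenter (n := m + 1))) rfl
    tupleBarycenter (affinePull σ (m + 1) φ)
  rw [tupleCoboundary_affinePull, hφ, map_zero, map_zero, zero_add] at h
  rw [Pi.sub_apply, ← affinePull_vertex σ (coboundary X m _), ← tupleCoboundary_affinePull,
    affinePull_subdivisionHomotopy, ← affinePull_vertex σ φ,
    ← affinePull_vertex σ (subdivision _ _), affinePull_subdivision]
  exact congrFun h _

/-! ### Cochains vanishing on small simplices -/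

/-- Cochains which vanish on the simplices contained in a member of `𝒰`. -/
def smallCochains (R : Type*) [CommRing R] (𝒰 : Set (Set X)) (n : ℕ) :
    Submodule R (Cochain R X n) :=
  ⨅ U ∈ 𝒰, relCochains R X U n

theorem mem_smallCochains {𝒰 : Set (Set X)} {n : ℕ} {φ : Cochain R X n} :
    φ ∈ smallCochains R 𝒰 n ↔ ∀ U ∈ 𝒰, φ ∈ relCochains R X U n := by
  simp [smallCochains]

theorem affinePull_eq_zero {U : Set X} {n m : ℕ} {σ : Simplex X n} (hσ : Set.range σ ⊆ U)
    {φ : Cochain R X m} (hφ : φ ∈ relCochains R X U m) : affinePull σ m φ = 0 := by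
  ext w
  refine hφ _ ?_
  rintro _ ⟨t, rfl⟩
  exact hσ ⟨_, rfl⟩

/-- Iterated subdivision eventually kills, on each simplex, the cochains which vanish on small
simplices. -/
theorem eventually_affinePull_subdivision_pow_eq_zero {𝒰 : Set (Set X)}
    (hU : ∀ U ∈ 𝒰, IsOpen U) (hcov : ⋃₀ 𝒰 = Set.univ) {n m : ℕ} (σ : Simplex X n)
    {φ : Cochain R X m} (hφ : φ ∈ smallCochains R 𝒰 m) :
    ∀ᶠ k in Filter.atTop, affinePull σ m ((subdivision m ^ k) φ) = 0 := by
  obtain ⟨δ, hδ, h⟩ := lebesgue_number_lemma_of_metric (s := Set.univ)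
    (c := fun U : 𝒰 => σ ⁻¹' (U : Set X)) isCompact_univ
    (fun U => (hU U U.2).preimage σ.continuous) (by
      intro x _
      have hx : σ x ∈ ⋃₀ 𝒰 := hcov ▸ Set.mem_univ _
      obtain ⟨U, hU, hxU⟩ := hx
      exact Set.mem_iUnion.2 ⟨⟨U, hU⟩, hxU⟩)
  have hc1 : ((m + 1 : ℕ) : ℝ) / ((m + 1 : ℕ) + 1) < 1 := by
    rw [div_lt_one (by positivity)]
    linarith
  have hlim := (tendsto_pow_atTop_nhds_zero_of_lt_one
    (r := ((m + 1 : ℕ) : ℝ) / ((m + 1 : ℕ) + 1)) (by positivity) hc1).eventually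
      (gt_mem_nhds hδ)
  filter_upwards [hlim] with k hk
  ext w
  rw [affinePull_subdivision_pow]
  -- The standard simplex has diameter at most `1`, so one `k` serves all tuples `w`. A degree `m`
  -- cochain sees tuples of `m + 1` points, whence `N`.
  refine tupleSubdivision_pow_apply_eq_zero (N := m + 1) (d := 1) dist_tupleBarycenter_le
    (fun x r k v hv => dist_affineSimplex_le hv _) le_rfl k (fun i j => ?_) fun v hv => ?_
  · exact (Metric.dist_le_diam_of_mem (bounded_stdSimplex _) (w i).2 (w j).2).trans
      diam_stdSimplex_le
  · obtain ⟨U, hU⟩ := h (v 0) (Set.mem_univ _)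
    refine (mem_smallCochains.1 hφ U U.2) _ ?_
    rintro _ ⟨t, rfl⟩
    refine hU (lt_of_le_of_lt (dist_affineSimplex_le (fun i => hv i 0) t) ?_)
    rwa [mul_one]

/-- The locally finite sum over all `k` of the subdivision homotopies of the `k`-fold
subdivisions. -/
def smallPrimitive {n : ℕ} (φ : Cochain R X (n + 1)) : Cochain R X n :=
  fun σ => ∑ᶠ k, subdivisionHomotopy n ((subdivision (n + 1) ^ k) φ) σ

theorem smallPrimitive_apply {n : ℕ} {φ : Cochain R X (n + 1)} {σ : Simplex X n} {N : ℕ}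
    (h : ∀ k, N ≤ k → affinePull σ (n + 1) ((subdivision (n + 1) ^ k) φ) = 0) :
    smallPrimitive φ σ =
      ∑ k ∈ Finset.range N, subdivisionHomotopy n ((subdivision (n + 1) ^ k) φ) σ := by
  refine finsum_eq_sum_of_support_subset _ fun k hk => ?_
  by_contra hkN
  refine hk ?_
  beta_reduce
  rw [subdivisionHomotopy_apply, h k (by simpa using hkN), map_zero, Pi.zero_apply]

theorem smallPrimitive_mem_relCochains {U : Set X} {n : ℕ} {φ : Cochain R X (n + 1)}
    (hφ : φ ∈ relCochains R X U (n + 1)) : smallPrimitive φ ∈ relCochains R X U n := by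
  intro σ hσ
  -- Subdividing a simplex inside `U` only yields simplices inside `U`, so already every term of the
  -- sum vanishes here.
  rw [smallPrimitive_apply (N := 0), Finset.sum_range_zero]
  intro k _
  rw [affinePull_subdivision_pow, affinePull_eq_zero hσ hφ, map_zero]

theorem coboundary_smallPrimitive {𝒰 : Set (Set X)} (hU : ∀ U ∈ 𝒰, IsOpen U)
    (hcov : ⋃₀ 𝒰 = Set.univ) {n : ℕ} {φ : Cochain R X (n + 1)}
    (hφ : φ ∈ smallCochains R 𝒰 (n + 1)) (hδ : coboundary X (n + 1) φ = 0) :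
    coboundary X n (smallPrimitive φ) = φ := by
  ext σ
  have h1 := eventually_affinePull_subdivision_pow_eq_zero hU hcov σ hφ
  have h2 : ∀ i : Fin (n + 2), ∀ᶠ k in Filter.atTop,
      affinePull (σ.pull i.succAbove) (n + 1) ((subdivision (n + 1) ^ k) φ) = 0 :=
    fun i => eventually_affinePull_subdivision_pow_eq_zero hU hcov _ hφ
  -- One bound for `σ` and its finitely many faces: the faces make the infinite sum finite, and `σ`
  -- itself removes the remainder of the telescope.
  obtain ⟨N, hN⟩ := Filter.eventually_atTop.1 (h1.and (Filter.eventually_all.2 h2))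
  have h3 : coboundary X n (smallPrimitive φ) σ = coboundary X n
      (∑ k ∈ Finset.range N, subdivisionHomotopy n ((subdivision (n + 1) ^ k) φ)) σ := by
    rw [coboundary_apply, coboundary_apply]
    refine Finset.sum_congr rfl fun i _ => ?_
    rw [smallPrimitive_apply fun k hk => (hN k hk).2 i, Finset.sum_apply]
  have h4 : ∀ k, coboundary X n (subdivisionHomotopy n ((subdivision (n + 1) ^ k) φ)) =
      (subdivision (n + 1) ^ k) φ - (subdivision (n + 1) ^ (k + 1)) φ := by
    intro k
    rw [coboundary_subdivisionHomotopy (coboundary_subdivision_pow hδ k), pow_succ',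
      Module.End.mul_apply]
  rw [h3, map_sum, Finset.sum_congr rfl fun k _ => h4 k, Finset.sum_range_sub', Pi.sub_apply,
    ← affinePull_vertex σ ((subdivision (n + 1) ^ N) φ), (hN N le_rfl).1]
  simp

/-- A cocycle which vanishes on the simplices contained in a member of an open cover is the
coboundary of such a cochain. -/
theorem mem_coboundaries_of_mem_smallCochains {𝒰 : Set (Set X)} (hU : ∀ U ∈ 𝒰, IsOpen U)
    (hcov : ⋃₀ 𝒰 = Set.univ) {A : Set X} (hA : ∃ U ∈ 𝒰, A ⊆ U) {n : ℕ} {φ : Cochain R X n}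
    (hφ : φ ∈ smallCochains R 𝒰 n) (hδ : coboundary X n φ = 0) :
    φ ∈ coboundaries R X A n := by
  cases n with
  | zero =>
    change φ = 0
    ext σ
    -- A `0`-simplex is a point, hence already small, so the cochain itself is zero.
    have hx : σ (stdSimplex.vertex 0) ∈ ⋃₀ 𝒰 := hcov ▸ Set.mem_univ _
    obtain ⟨U, hU, hxU⟩ := hx
    refine mem_smallCochains.1 hφ U hU σ ?_
    rintro _ ⟨t, rfl⟩
    rwa [Subsingleton.elim t (stdSimplex.vertex 0)]
  | succ n =>
    obtain ⟨U, hU', hAU⟩ := hA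
    exact ⟨_, fun σ hσ => smallPrimitive_mem_relCochains (mem_smallCochains.1 hφ U hU') σ
      (hσ.trans hAU), coboundary_smallPrimitive hU hcov hφ hδ⟩

end Subdivision

/-! ### Cup products of classes vanishing on open sets -/

section CupLength

variable {R : Type*} [CommRing R] {X : Type*} [TopologicalSpace X] {A : Set X}

/-- On a simplex inside a member of `𝒰` the front factor vanishes, and inside a member of `𝒱` the
back factor does, since faces stay in the same set. -/
theorem cup_mem_smallCochains {𝒰 𝒱 : Set (Set X)} {p q n : ℕ} (h : p + q = n)
    {φ : Cochain R X p} {ψ : Cochain R X q} (hφ : φ ∈ smallCochains R 𝒰 p)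
    (hψ : ψ ∈ smallCochains R 𝒱 q) : cup h φ ψ ∈ smallCochains R (𝒰 ∪ 𝒱) n := by
  refine mem_smallCochains.2 ?_
  rintro U (hU | hU)
  · exact cup_mem_relCochains h (mem_smallCochains.1 hφ U hU) ψ
  · intro σ hσ
    exact mul_eq_zero_of_right _
      (mem_smallCochains.1 hψ U hU _ ((σ.range_pull _).trans hσ))

variable (R A) in
/-- The classes which are represented by cocycles vanishing on all simplices contained in a member
of `𝒰`. -/
def vanishingClasses (𝒰 : Set (Set X)) (n : ℕ) : Submodule R (Cohomology R X A n) :=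
  ((smallCochains R 𝒰 n).comap (cocycles R X A n).subtype).map (cls n)

variable (R A) in
/-- The elements of total cohomology which are represented by cocycles vanishing on all simplices
contained in a member of `𝒰`. -/
def totalVanishingClasses (𝒰 : Set (Set X)) : AddSubgroup (TotalCohomology R X A) where
  carrier := {a | ∀ n, a n ∈ vanishingClasses R A 𝒰 n}
  add_mem' ha hb n := add_mem (ha n) (hb n)
  zero_mem' _ := zero_mem _
  neg_mem' ha n := neg_mem (ha n)

theorem of_mem_totalVanishingClasses {𝒰 : Set (Set X)} {n : ℕ} {a : Cohomology R X A n}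
    (ha : a ∈ vanishingClasses R A 𝒰 n) :
    DirectSum.of (Cohomology R X A) n a ∈ totalVanishingClasses R A 𝒰 := by
  intro k
  by_cases h : n = k
  · subst h
    rwa [DirectSum.of_eq_same]
  · rw [DirectSum.of_eq_of_ne _ _ _ (Ne.symm h)]
    exact zero_mem _

theorem mul_mem_totalVanishingClasses {𝒰 𝒱 : Set (Set X)} {a b : TotalCohomology R X A}
    (ha : a ∈ totalVanishingClasses R A 𝒰) (hb : b ∈ totalVanishingClasses R A 𝒱) :
    a * b ∈ totalVanishingClasses R A (𝒰 ∪ 𝒱) := by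
  classical
  -- Splitting into homogeneous components reduces the claim to cup products of representing
  -- cocycles.
  rw [← DirectSum.sum_support_of a, ← DirectSum.sum_support_of b, Finset.sum_mul_sum]
  refine sum_mem fun p _ => sum_mem fun q _ => ?_
  obtain ⟨φ, hφ, hφa⟩ := ha p
  obtain ⟨ψ, hψ, hψb⟩ := hb q
  rw [← hφa, ← hψb, of_mul_of_cls]
  exact of_mem_totalVanishingClasses ⟨_, cup_mem_smallCochains rfl hφ hψ, rfl⟩

theorem mulSeq_mem_totalVanishingClasses {k : ℕ} {U : Fin (k + 1) → Set X}
    {a : Fin (k + 1) → TotalCohomology R X A}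
    (ha : ∀ i, a i ∈ totalVanishingClasses R A {U i}) :
    mulSeq k a ∈ totalVanishingClasses R A (Set.range U) := by
  induction k with
  | zero =>
    have h : Set.range U = {U 0} := by
      ext V
      simp [eq_comm]
    rw [h]
    exact ha 0
  | succ k ih =>
    have h : Set.range U = Set.range (fun i : Fin (k + 1) => U i.castSucc) ∪
        {U (Fin.last (k + 1))} := by
      ext V
      simp only [Set.mem_range, Set.mem_union, Set.mem_singleton_iff, Fin.exists_iff_castSucc,
        @eq_comm _ V, or_comm]
    rw [h]
    exact mul_mem_totalVanishingClasses (ih fun i => ha _) (ha _)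

/-- A class vanishing on the members of an open cover is zero. -/
theorem eq_zero_of_mem_totalVanishingClasses {𝒰 : Set (Set X)} (hU : ∀ U ∈ 𝒰, IsOpen U)
    (hcov : ⋃₀ 𝒰 = Set.univ) (hA : ∃ U ∈ 𝒰, A ⊆ U) {a : TotalCohomology R X A}
    (ha : a ∈ totalVanishingClasses R A 𝒰) : a = 0 := by
  refine DFinsupp.ext fun n => ?_
  obtain ⟨φ, hφ, hφa⟩ := ha n
  rw [← hφa]
  exact cls_eq_zero (mem_coboundaries_of_mem_smallCochains hU hcov hA hφ φ.2.2)

/-- Extension by zero off the simplices of `U`. The result is still relative to `A`, because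
simplices of `A` lie in `U` and there come from `A'`. -/
theorem exists_pullCochain_eq {U : Set X} {A' : Set U} (hA : ∀ x ∈ A, ∃ hx : x ∈ U, ⟨x, hx⟩ ∈ A')
    {n : ℕ} {χ : Cochain R U n} (hχ : χ ∈ relCochains R U A' n) :
    ∃ χ' ∈ relCochains R X A n,
      pullCochain ⟨Subtype.val, continuous_subtype_val⟩ n χ' = χ := by
  classical
  refine ⟨fun σ => if h : ∀ t, σ t ∈ U then
    χ ⟨fun t => ⟨σ t, h t⟩, σ.continuous.subtype_mk h⟩ else 0, fun σ hσ => ?_, ?_⟩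
  · have h : ∀ t, σ t ∈ U := fun t => (hA _ (hσ ⟨t, rfl⟩)).1
    refine (dif_pos h).trans (hχ _ ?_)
    rintro _ ⟨t, rfl⟩
    exact (hA _ (hσ ⟨t, rfl⟩)).2
  · ext σ
    exact dif_pos fun t => (σ t).2

theorem cls_eq_zero_iff {n : ℕ} {φ : cocycles R X A n} :
    cls n φ = 0 ↔ (φ : Cochain R X n) ∈ coboundaries R X A n :=
  Submodule.Quotient.mk_eq_zero _

/-- A class which restricts to zero on `U` is represented by a cocycle vanishing on `U`. -/
theorem mem_vanishingClasses_of_cohomologyMap_eq_zero {U : Set X} {A' : Set U}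
    (hA : ∀ x ∈ A, ∃ hx : x ∈ U, ⟨x, hx⟩ ∈ A') {n : ℕ}
    (hi : Set.MapsTo (⟨Subtype.val, continuous_subtype_val⟩ : C(U, X)) A' A)
    {a : Cohomology R X A n} (ha : cohomologyMap (R := R) _ hi n a = 0) :
    a ∈ vanishingClasses R A {U} n := by
  have key : ∀ φ : Cochain R X n,
      pullCochain (⟨Subtype.val, continuous_subtype_val⟩ : C(U, X)) n φ = 0 →
        φ ∈ smallCochains R {U} n := by
    intro φ hφ
    refine mem_smallCochains.2 ?_
    rintro _ rfl σ hσ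
    exact congrFun hφ ⟨fun t => ⟨σ t, hσ ⟨t, rfl⟩⟩, σ.continuous.subtype_mk _⟩
  obtain ⟨φ, rfl⟩ := cls_surjective n a
  have h1 : pullCochain (⟨Subtype.val, continuous_subtype_val⟩ : C(U, X)) n
      (φ : Cochain R X n) ∈ coboundaries R U A' n :=
    cls_eq_zero_iff (φ := ⟨_, pullCochain_mem_cocycles _ hi φ.2⟩).1 ha
  cases n with
  -- In degree `0` the only coboundary is zero, so `φ` itself already vanishes on `U`.
  | zero => exact ⟨φ, key _ h1, rfl⟩
  | succ n =>
    obtain ⟨χ, hχ, hχφ⟩ := h1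
    obtain ⟨χ', hχ', rfl⟩ := exists_pullCochain_eq hA hχ
    have h2 : coboundary X n χ' ∈ coboundaries R X A (n + 1) := ⟨χ', hχ', rfl⟩
    have h3 : coboundary X n χ' ∈ cocycles R X A (n + 1) :=
      ⟨coboundary_mem_relCochains hχ', coboundary_coboundary χ'⟩
    -- Subtracting the coboundary of the extended primitive keeps the class and kills the
    -- restriction to `U`.
    refine ⟨φ - ⟨_, h3⟩, key ((φ : Cochain R X (n + 1)) - coboundary X n χ') ?_, ?_⟩
    · rw [map_sub, ← coboundary_pullCochain, hχφ, sub_self]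
    · rw [map_sub, cls_eq_zero (φ := ⟨_, h3⟩) h2, sub_zero]

end CupLength

/-! ### Sectional category and homotopic distance -/

universe u v w

variable {R : Type*} [CommRing R] {B : Type u} [TopologicalSpace B]

theorem mem_ker_pullback_iff {E : Space.{u, v} B} {X : Space.{u, w} B} {f : Map E X}
    {a : FibCohomology R X} : a ∈ TwoSidedIdeal.ker (f.pullback R) ↔
      ∀ n, cohomologyMap f.toMap f.mapsTo n (a n) = 0 := by
  rw [TwoSidedIdeal.mem_ker, DFinsupp.ext_iff]
  rfl

/-- Homotopy invariance factors restriction to `U` as `s^*` after `f^*`, so the kernel of `f^*`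
restricts to zero. -/
theorem mem_totalVanishingClasses_of_section {E : Space.{u, v} B} {X : Space.{u, w} B}
    {f : Map E X} {U : Set X} {hU : Set.range X.sec ⊆ U} {s : Map (X.subspace U hU) E}
    (hs : (f.comp s).Homotopic (X.incl U hU)) {a : FibCohomology R X}
    (ha : a ∈ TwoSidedIdeal.ker (f.pullback R)) :
    a ∈ totalVanishingClasses R (Set.range X.sec) {U} := by
  intro n
  obtain ⟨H⟩ := hs
  have h1 : cohomologyMap (R := R) (X.incl U hU).toMap (X.incl U hU).mapsTo n =
      cohomologyMap s.toMap s.mapsTo n ∘ₗ cohomologyMap f.toMap f.mapsTo n := by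
    rw [← cohomologyMap_eq_of_homotopy (f.comp s).mapsTo (X.incl U hU).mapsTo H.toHomotopy]
    · ext a
      obtain ⟨φ, rfl⟩ := cls_surjective n a
      rfl
    · rintro t _ ⟨b, rfl⟩
      -- Pointedness at every time keeps the section inside the section, making this a homotopy of
      -- pairs.
      exact ⟨b, ((H.prop t).2 b).symm⟩
  refine mem_vanishingClasses_of_cohomologyMap_eq_zero (U := U)
    (A' := Set.range (X.subspace U hU).sec) ?_ (X.incl U hU).mapsTo ?_
  · rintro _ ⟨b, rfl⟩
    exact ⟨hU ⟨b, rfl⟩, b, rfl⟩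
  · refine (LinearMap.congr_fun h1 (a n)).trans ?_
    rw [LinearMap.comp_apply, mem_ker_pullback_iff.1 ha n, map_zero]
    rfl

theorem nilpotency_ker_pullback_le_secat {E : Space.{u, v} B} {X : Space.{u, w} B}
    (f : Map E X) : nilpotency (TwoSidedIdeal.ker (f.pullback R)) ≤ secat f := by
  refine le_iInf₂ fun n hn => ?_
  obtain ⟨U, hUo, hUc, hU⟩ := hn
  refine iInf₂_le n fun a ha => ?_
  -- The section lies in every `U i`. Taking `U 0` as the member containing it makes the primitive a
  -- relative cochain.
  refine eq_zero_of_mem_totalVanishingClasses (𝒰 := Set.range U) (by simpa using hUo)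
    (by rwa [Set.sUnion_range]) ⟨U 0, ⟨0, rfl⟩, (hU 0).1⟩
    (mulSeq_mem_totalVanishingClasses fun i => ?_)
  obtain ⟨hi, s, hs⟩ := hU i
  exact mem_totalVanishingClasses_of_section hs (ha i)

theorem exists_section_of_homotopic {X : Space.{u, v} B} {Y : Space.{u, w} B} {f g : Map X Y}
    {U : Set X} {hU : Set.range X.sec ⊆ U}
    (h : (f.comp (X.incl U hU)).Homotopic (g.comp (X.incl U hU))) :
    ∃ s : Map (X.subspace U hU) (pathPullback f g),
      (pathPullbackProj f g).comp s = X.incl U hU := by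
  obtain ⟨H⟩ := h
  -- Currying turns the homotopy into a continuous family of paths. Fibrewise times keep each path
  -- in one fibre, and pointedness makes the paths over the section constant.
  let γ : C(U, C(unitInterval, Y)) :=
    (H.toContinuousMap.comp ⟨Prod.swap, continuous_swap⟩).curry
  have hγ : ∀ x t, γ x t = H (t, x) := fun _ _ => rfl
  refine ⟨⟨⟨fun x => ⟨(x.1, ⟨(X.proj x.1, γ x), ?_⟩), ?_⟩, ?_⟩, fun x => rfl, fun b => ?_⟩, rfl⟩
  · ext t
    exact ((H.prop t).1 x).symm
  · refine Subtype.ext (Prod.ext ?_ ?_)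
    · exact (H.apply_zero x).symm
    · exact (H.apply_one x).symm
  · refine Continuous.subtype_mk (continuous_subtype_val.prodMk (Continuous.subtype_mk ?_ _)) _
    exact (X.proj.continuous.comp continuous_subtype_val).prodMk γ.continuous
  · refine Subtype.ext (Prod.ext rfl (Subtype.ext (Prod.ext (X.proj_sec b) ?_)))
    ext t
    exact (H.prop t).2 b

/-- The same open cover serves both invariants, as the sections obtained are strict and the required
homotopy can be constant. -/
theorem secat_pathPullbackProj_le_distance {X : Space.{u, v} B} {Y : Space.{u, w} B}
    (f g : Map X Y) : secat (pathPullbackProj f g) ≤ distance f g := by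
  refine le_iInf₂ fun n hn => ?_
  obtain ⟨U, hUo, hUc, hU⟩ := hn
  refine iInf₂_le n ⟨U, hUo, hUc, fun i => ?_⟩
  obtain ⟨hi, h⟩ := hU i
  obtain ⟨s, hs⟩ := exists_section_of_homotopic h
  refine ⟨hi, s, ?_⟩
  rw [hs]
  exact ⟨ContinuousMap.HomotopyWith.refl _ (X.incl (U i) hi).isFibrewisePointed⟩

end FibrewisePointed

end

theorem mainTheorem9 {R : Type*} [CommRing R] {B : Type*} [TopologicalSpace B] :
    (∀ (E X : Space B) (π : Map E X),
      nilpotency (TwoSidedIdeal.ker (π.pullback R)) ≤ secat π) ∧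
    (∀ (X Y : Space B) (f g : Map X Y),
      nilpotency (TwoSidedIdeal.ker ((pathPullbackProj f g).pullback R)) ≤ distance f g) :=
  ⟨fun _ _ π => nilpotency_ker_pullback_le_secat π, fun _ _ f g =>
    (nilpotency_ker_pullback_le_secat _).trans (secat_pathPullbackProj_le_distance f g)⟩
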